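/- Let $n\ge 2$ and let $\mathcal G$ be a strongly connected weighted digraph on $\{1,\dots,n\}$ with weights $w_{ij}\ge 0$ ($i\ne j$), where $(j,i)$ is an edge iff $i\neq j$ and $w_{ij}\ne 0$. Let $\mathbf L$ be its Laplacian ($l_{ii}=\sum_{k\ne i}w_{ik}$, $l_{ij}=-w_{ij}$ for $i\neq j$), let $\tilde\lambda(\mathbf L)=\min\{\Re\lambda:\lambda\neq 0\text{ an eigenvalue of }\mathbf L\}$ be the generalized algebraic connectivity, let $\mathbf w_1\in\mathbb R^n$ be a unit vector with $\mathbf w_1^{\mathsf T}\mathbf L=0$, let $0<\delta<\big(\max_i\sum_{j\ne i}w_{ij}\big)^{-1}$, and put $$\tilde{\mathbf L}=e^{\mathbf I-\delta\mathbf L}-e\,\mathbf w_1\mathbf w_1^{\mathsf T}.$$ Assume that $\tilde{\mathbf L}$ has a simple dominant eigenvalue $\lambda_n$: $\lambda_n$ has algebraic multiplicity one and $|\mu|<|\lambda_n|$ for every eigenvalue $\mu\ne\lambda_n,\overline{\lambda_n}$ (a complex conjugate pair counts as one dominant eigenvalue). Let $\mathbf x_0\in\mathbb C^n$ be a unit vector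 whose expansion in (generalized) eigenvectors of $\tilde{\mathbf L}$ has nonzero components for $\lambda_n$ and for $\overline{\lambda_n}$ (for real $\mathbf x_0$ these two conditions are equivalent). For a matrix $\mathbf Q$ with independent columns put $\mathfrak f(\mathbf Q)=\mathbf Q(\mathbf Q^{\mathsf H}\mathbf Q)^{-1}\mathbf Q^{\mathsf H}$ and $\mathfrak g(\tilde{\mathbf L},\mathbf Q)=(\mathbf Q^{\mathsf H}\mathbf Q)^{-1}\mathbf Q^{\mathsf H}\tilde{\mathbf L}\mathbf Q$ (in both, the inverse is read as $0$ should the columns be dependent). For $k\ge1$ the centralized generalized power iteration computes $\mathbf x_k=\tilde{\mathbf L}\mathbf x_{k-1}/\|\tilde{\mathbf L}\mathbf x_{k-1}\|$, $\check{\mathbf Q}_k=\mathbf x_k$, $\hat{\mathbf Q}_k=[\mathbf x_{k-1}\ \mathbf x_k]$; with $\check{\mathbf P}_k=\mathfrak f(\check{\mathbf Q}_k)$, $\hat{\mathbf P}_k=\mathfrak f(\hat{\mathbf Q}_k)$, $\check{\mathbf P}_0=\hat{\mathbf P}_0=0$, the distances $\check d_k=\|\check{\mathbf P}_k-\check{\mathbf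 P}_{k-1}\|$ and $\hat d_k=\|\hat{\mathbf P}_k-\hat{\mathbf P}_{k-1}\|$ (spectral norm); with $\hat{\mathbf R}_k=\mathfrak g(\tilde{\mathbf L},\hat{\mathbf Q}_k)$, the values $\check\lambda_k=|\mathfrak g(\tilde{\mathbf L},\check{\mathbf Q}_k)|=|\mathbf x_k^{\mathsf H}\tilde{\mathbf L}\mathbf x_k|$ and $\hat\lambda_k=\big|\tfrac12\operatorname{tr}\hat{\mathbf R}_k+\sqrt{(\tfrac12\operatorname{tr}\hat{\mathbf R}_k)^2-\det\hat{\mathbf R}_k}\big|$ (principal square root); and finally $d_{k+1}=\min\{\check d_k,\hat d_k\}$ and $\tilde\lambda_{k+1}=\frac1\delta[1-\log\check\lambda_k]$ if $d_{k+1}=\check d_k$, $\tilde\lambda_{k+1}=\frac1\delta[1-\log\hat\lambda_k]$ otherwise. Started with $d_1=\epsilon>0$, the loop stops as soon as $d_k<\epsilon$. Then the minimum defining $\tilde\lambda(\mathbf L)$ exists, $\tilde{\mathbf L}\mathbf x_k\neq 0$ for all $k\ge 0$, and for the sequences continued without stopping $$\lim_{k\to\infty}\tilde\lambda_k=\tilde\lambda(\mathbf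 L),\qquad \lim_{k\to\infty}d_k=0,$$ so that the loop stops after finitely many iterations for every $\epsilon>0$. Moreover: 1. if $\lambda_n$ is real, then $\check{\mathbf P}_k$ converges to the orthogonal projection matrix onto the eigenspace $\operatorname{span}\{\mathbf v_n\}$ of $\lambda_n$, and $\check\lambda_k\to|\lambda_n|$; 2. if $\lambda_n$ is not real, then $\hat{\mathbf P}_k$ converges to the orthogonal projection matrix onto $\operatorname{span}\{\mathbf v_{n-1},\mathbf v_n\}$, the span of the eigenvectors for $\overline{\lambda_n}$ and $\lambda_n$, and $\hat\lambda_k\to|\lambda_n|$. -/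

import Mathlib

open Filter Topology
open scoped Matrix ComplexConjugate

namespace GPI

/-! ### Weighted digraphs, Laplacian, generalized algebraic connectivity -/

/-- A weighted digraph on the vertices `Fin n`, given by its weight matrix. `w j i` is the weight
of the edge `(i, j)`; diagonal entries are irrelevant. -/
structure WeightedDigraph (n : ℕ) where
  w : Matrix (Fin n) (Fin n) ℝ
  nonneg : ∀ i j, i ≠ j → 0 ≤ w i j

namespace WeightedDigraph

variable {n : ℕ} (G : WeightedDigraph n)

/-- `(i, j)` is a directed edge. -/
def Edge (i j : Fin n) : Prop := i ≠ j ∧ G.w j i ≠ 0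

/-- There is a directed path between every ordered pair of distinct vertices. -/
def StronglyConnected : Prop := ∀ i j : Fin n, i ≠ j → Relation.TransGen G.Edge i j

open Classical in
/-- The Laplacian matrix. -/
noncomputable def laplacian : Matrix (Fin n) (Fin n) ℝ :=
  Matrix.of fun i j =>
    if G.Edge j i then -G.w i j
    else if j = i then ∑ k ∈ Finset.univ.filter (fun k => k ≠ i), G.w i k
    else 0

open Classical in
/-- The maximal total in-weight `Δ = max_i ∑_{j ∈ N_i} w_ij`, with `N_i` the in-neighbors of `i`. -/
noncomputable def maxInWeight : ℝ :=
  ⨆ i : Fin n, ∑ j ∈ Finset.univ.filter (fun j => G.Edge j i), G.w i j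

/-- The real parts of the nonzero (complex) eigenvalues of the Laplacian. -/
noncomputable def nonzeroEigenvalueRe : Set ℝ :=
  {r | ∃ μ : ℂ, μ ∈ spectrum ℂ (G.laplacian.map (algebraMap ℝ ℂ)) ∧ μ ≠ 0 ∧ μ.re = r}

/-- The generalized algebraic connectivity: the minimum of the real parts of the nonzero
eigenvalues of the Laplacian. -/
noncomputable def gac : ℝ := sInf G.nonzeroEigenvalueRe

/-- The modified Laplacian `e^{I - δ L} - e w₁ w₁ᵀ`, as a complex matrix. -/
noncomputable def modifiedLaplacian (δ : ℝ) (w₁ : EuclideanSpace ℝ (Fin n)) :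
    Matrix (Fin n) (Fin n) ℂ :=
  (NormedSpace.exp (1 - δ • G.laplacian)
    - Real.exp 1 • Matrix.vecMulVec w₁.ofLp w₁.ofLp).map (algebraMap ℝ ℂ)

end WeightedDigraph

/-! ### Dominant eigenvalue and spectral components -/

/-- `lam` is an eigenvalue of `M` of algebraic multiplicity one, and every eigenvalue other than
`lam` and its conjugate has strictly smaller modulus. (For a real matrix, a nonreal dominant
eigenvalue comes with its conjugate; the pair counts as one dominant eigenvalue.) -/
def IsSimpleDominant {n : ℕ} (M : Matrix (Fin n) (Fin n) ℂ) (lam : ℂ) : Prop :=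
  M.charpoly.rootMultiplicity lam = 1 ∧
    ∀ μ ∈ spectrum ℂ M, μ ≠ lam → μ ≠ conj lam → ‖μ‖ < ‖lam‖

/-- In the decomposition of `x` into generalized eigenvectors of `M`, the component for the
eigenvalue `μ` is nonzero: `x` is not a sum of generalized eigenvectors for other eigenvalues. -/
def HasSpectralComponent {n : ℕ} (M : Matrix (Fin n) (Fin n) ℂ) (μ : ℂ)
    (x : EuclideanSpace ℂ (Fin n)) : Prop :=
  x.ofLp ∉ ⨆ ν ∈ {ν : ℂ | ν ≠ μ}, Module.End.maxGenEigenspace (Matrix.toLin' M) ν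

/-! ### Projections onto column spaces -/

/-- `f(Q) = Q (Qᴴ Q)⁻¹ Qᴴ`. -/
noncomputable def proj {n m : ℕ} (Q : Matrix (Fin n) (Fin m) ℂ) : Matrix (Fin n) (Fin n) ℂ :=
  Q * (Qᴴ * Q)⁻¹ * Qᴴ

/-- `g(A, Q) = (Qᴴ Q)⁻¹ Qᴴ A Q`. -/
noncomputable def compress {n m : ℕ} (A : Matrix (Fin n) (Fin n) ℂ)
    (Q : Matrix (Fin n) (Fin m) ℂ) : Matrix (Fin m) (Fin m) ℂ :=
  (Qᴴ * Q)⁻¹ * Qᴴ * A * Q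

open scoped Matrix.Norms.L2Operator in
/-- The distance of two subspaces in terms of their projection matrices: the norm of the
difference, as an operator for the Euclidean norm. -/
noncomputable def projDist {n : ℕ} (P₁ P₂ : Matrix (Fin n) (Fin n) ℂ) : ℝ := ‖P₁ - P₂‖

/-- The one-column matrix `x`. -/
def oneCol {n : ℕ} (x : EuclideanSpace ℂ (Fin n)) : Matrix (Fin n) (Fin 1) ℂ :=
  Matrix.of fun i _ => x i

/-- The two-column matrix `[x y]`. -/
def twoCol {n : ℕ} (x y : EuclideanSpace ℂ (Fin n)) : Matrix (Fin n) (Fin 2) ℂ :=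
  Matrix.of fun i j => ![x i, y i] j

/-! ### The centralized generalized power iteration
All sequences are those of the iteration run without stopping; the stopping rule is expressed
through `dist`. -/

section Algorithm

variable {n : ℕ} (M : Matrix (Fin n) (Fin n) ℂ) (x₀ : EuclideanSpace ℂ (Fin n))

/-- The intermediate vector `M x`. -/
noncomputable def apply (x : EuclideanSpace ℂ (Fin n)) : EuclideanSpace ℂ (Fin n) :=
  WithLp.toLp 2 (M *ᵥ x.ofLp)

/-- The state vectors: `x_{k+1} = M x_k / ‖M x_k‖`. -/
noncomputable def state : ℕ → EuclideanSpace ℂ (Fin n)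
  | 0 => x₀
  | k + 1 => ‖apply M (state k)‖⁻¹ • apply M (state k)

/-- One-dimensional projection matrices, initialized with `0`. -/
noncomputable def projOne : ℕ → Matrix (Fin n) (Fin n) ℂ
  | 0 => 0
  | k + 1 => proj (oneCol (state M x₀ (k + 1)))

/-- Two-dimensional projection matrices, initialized with `0`. -/
noncomputable def projTwo : ℕ → Matrix (Fin n) (Fin n) ℂ
  | 0 => 0
  | k + 1 => proj (twoCol (state M x₀ k) (state M x₀ (k + 1)))

/-- The distance between the `k`-th and the `(k+1)`-st one-dimensional subspace. -/
noncomputable def distOne (k : ℕ) : ℝ := projDist (projOne M x₀ (k + 1)) (projOne M x₀ k)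

/-- The distance between the `k`-th and the `(k+1)`-st two-dimensional subspace. -/
noncomputable def distTwo (k : ℕ) : ℝ := projDist (projTwo M x₀ (k + 1)) (projTwo M x₀ k)

/-- The modulus of the projection of `M` to the `(k+1)`-st one-dimensional subspace. -/
noncomputable def lamOne (k : ℕ) : ℝ := ‖compress M (oneCol (state M x₀ (k + 1))) 0 0‖

/-- For a `2 × 2` matrix `R`, the modulus of its eigenvalue `tr R / 2 + √((tr R / 2)² - det R)`,
with the principal square root. -/
noncomputable def eigAbs (R : Matrix (Fin 2) (Fin 2) ℂ) : ℝ :=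
  ‖R.trace / 2 + ((R.trace / 2) ^ 2 - R.det) ^ (1 / 2 : ℂ)‖

/-- The eigenvalue modulus for the projection of `M` to the `(k+1)`-st two-dimensional subspace. -/
noncomputable def lamTwo (k : ℕ) : ℝ :=
  eigAbs (compress M (twoCol (state M x₀ k) (state M x₀ (k + 1))))

/-- The distances `d_k` that control the loop: `d_1 = ε`, and `d_{k+1}` is the smaller of the two
distances of iteration `k`. (The index `0` is not used by the algorithm.) -/
noncomputable def dist (ε : ℝ) : ℕ → ℝ
  | 0 => ε
  | 1 => ε
  | k + 2 => min (distOne M x₀ k) (distTwo M x₀ k)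

/-- The estimates `λ̃_k`, `k ≥ 2`, of the generalized algebraic connectivity, computed in iteration
`k - 1`. (The algorithm does not compute the values with index `0` and `1`.) -/
noncomputable def gacEstimate (δ : ℝ) : ℕ → ℝ
  | 0 => 0
  | 1 => 0
  | k + 2 =>
    if min (distOne M x₀ k) (distTwo M x₀ k) = distOne M x₀ k then
      1 / δ * (1 - Real.log (lamOne M x₀ k))
    else
      1 / δ * (1 - Real.log (lamTwo M x₀ k))

end Algorithm

end GPI

namespace GPI

/-! ### Projections and compressions -/

/-! Let M be the modified Laplacian. A left null vector of L is orthogonal to every right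
eigenvector for a nonzero eigenvalue, so subtracting e w₁w₁ᵀ only replaces the eigenvalue e by 0.
The nonzero eigenvalues of M are therefore exactly exp(1 - δμ) with μ a nonzero eigenvalue of L, and
the dominant modulus is exp(1 - δ·gac) (`isLeast_gac_and_norm_eq`). Gershgorin's theorem gives |δ Im
μ| ≤ 1 < π/2, hence Re lam > 0 (`IsSimpleDominant.re_pos`).

If lam is real, it is positive and the states converge to an eigenvector. If not, suitable
combinations of two consecutive states converge to the two dominant eigenvectors, so the planes
converge. Either way one of the two distances tends to 0, and the eigenvalue estimate of matching
dimension converges.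

The difficulty is that the algorithm may use the estimate of the other dimension infinitely often.
It does so only when the other distance is no larger, so that distance then also tends to 0. Since M
maps the k-th subspace into the next one, (1 - P_{k+1}) M P_k = 0. Along an ultrafilter selecting
these iterations, P_k and P_{k+1} have a common limit P, so the range of P is M-invariant. In the
real case it is a plane through the dominant eigenvector, and the principal root selects lam
(`tendsto_lamTwo_of_distTwo_lt`). In the nonreal case it is a line inside the dominant plane, so its
eigenvalue is lam or its conjugate (`tendsto_lamOne_of_distOne_le`). An ultrafilter decides which
branch is taken, and `tendsto_gacEstimate` combines the two cases. -/

open scoped ComplexOrder in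
theorem det_gram_ne_zero {n m : ℕ} {Q : Matrix (Fin n) (Fin m) ℂ}
    (hQ : ∀ c, Q *ᵥ c = 0 → c = 0) : (Qᴴ * Q).det ≠ 0 := by
  intro h
  obtain ⟨c, hc, h0⟩ := Matrix.exists_mulVec_eq_zero_iff.mpr h
  exact hc (hQ c ((Matrix.conjTranspose_mul_self_mulVec_eq_zero Q c).mp h0))

/-- The projection depends only on the column space. This permits replacing nearly parallel columns
by a basis that converges to an independent one. -/
theorem proj_mul_right {n m : ℕ} (Q : Matrix (Fin n) (Fin m) ℂ) {T : Matrix (Fin m) (Fin m) ℂ}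
    (hT : T.det ≠ 0) : proj (Q * T) = proj Q := by
  have hT' : IsUnit T.det := hT.isUnit
  have hT'' : IsUnit Tᴴ.det := by
    rw [Matrix.det_conjTranspose]; exact hT'.star
  unfold proj
  have e : (Q * T)ᴴ * (Q * T) = Tᴴ * ((Qᴴ * Q) * T) := by
    rw [Matrix.conjTranspose_mul]; simp only [Matrix.mul_assoc]
  rw [e, Matrix.mul_inv_rev, Matrix.mul_inv_rev, Matrix.conjTranspose_mul]
  calc Q * T * (T⁻¹ * (Qᴴ * Q)⁻¹ * Tᴴ⁻¹) * (Tᴴ * Qᴴ)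
      = Q * (T * T⁻¹) * (Qᴴ * Q)⁻¹ * (Tᴴ⁻¹ * Tᴴ) * Qᴴ := by simp only [Matrix.mul_assoc]
    _ = _ := by rw [Matrix.mul_nonsing_inv _ hT', Matrix.nonsing_inv_mul _ hT'']; simp

theorem compress_mul_right {n m : ℕ} (A : Matrix (Fin n) (Fin n) ℂ) (Q : Matrix (Fin n) (Fin m) ℂ)
    {T : Matrix (Fin m) (Fin m) ℂ} (hT : T.det ≠ 0) :
    compress A (Q * T) = T⁻¹ * compress A Q * T := by
  have hT' : IsUnit T.det := hT.isUnit
  have hT'' : IsUnit Tᴴ.det := by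
    rw [Matrix.det_conjTranspose]; exact hT'.star
  unfold compress
  have e : (Q * T)ᴴ * (Q * T) = Tᴴ * ((Qᴴ * Q) * T) := by
    rw [Matrix.conjTranspose_mul]; simp only [Matrix.mul_assoc]
  rw [e, Matrix.mul_inv_rev, Matrix.mul_inv_rev, Matrix.conjTranspose_mul]
  calc T⁻¹ * (Qᴴ * Q)⁻¹ * Tᴴ⁻¹ * (Tᴴ * Qᴴ) * A * (Q * T)
      = T⁻¹ * (Qᴴ * Q)⁻¹ * (Tᴴ⁻¹ * Tᴴ) * Qᴴ * A * (Q * T) := by simp only [Matrix.mul_assoc]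
    _ = _ := by rw [Matrix.nonsing_inv_mul _ hT'']; simp [Matrix.mul_assoc]

/-- A change of basis conjugates the compression, and `eigAbs` sees only trace and determinant. -/
theorem eigAbs_compress_mul_right {n : ℕ} (A : Matrix (Fin n) (Fin n) ℂ)
    (Q : Matrix (Fin n) (Fin 2) ℂ) {T : Matrix (Fin 2) (Fin 2) ℂ} (hT : T.det ≠ 0) :
    eigAbs (compress A (Q * T)) = eigAbs (compress A Q) := by
  have hT' : IsUnit T.det := hT.isUnit
  have hu : IsUnit T := (Matrix.isUnit_iff_isUnit_det _).2 hT'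
  have h1 : (T⁻¹ * compress A Q * T).trace = (compress A Q).trace := by
    rw [Matrix.trace_mul_comm, ← Matrix.mul_assoc, Matrix.mul_nonsing_inv _ hT', Matrix.one_mul]
  have h2 : (T⁻¹ * compress A Q * T).det = (compress A Q).det := Matrix.det_conj' hu _
  rw [compress_mul_right A Q hT, eigAbs, eigAbs, h1, h2]

theorem proj_mul_self {n m : ℕ} {Q : Matrix (Fin n) (Fin m) ℂ} (hQ : (Qᴴ * Q).det ≠ 0) :
    proj Q * Q = Q := by
  unfold proj
  rw [Matrix.mul_assoc, Matrix.mul_assoc, Matrix.nonsing_inv_mul _ hQ.isUnit, Matrix.mul_one]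

/-- The conclusion says that A carries one column space into the other in terms of projections
alone, so it passes to limits of projections. Only the target columns need be independent. -/
theorem one_sub_proj_mul_mul_proj {n m : ℕ} {A : Matrix (Fin n) (Fin n) ℂ}
    {Q Q' : Matrix (Fin n) (Fin m) ℂ} {S : Matrix (Fin m) (Fin m) ℂ}
    (hQ' : (Q'ᴴ * Q').det ≠ 0) (h : A * Q = Q' * S) : (1 - proj Q') * A * proj Q = 0 := by
  have : (1 - proj Q') * (A * Q) = 0 := by
    rw [h, ← Matrix.mul_assoc, Matrix.sub_mul, proj_mul_self hQ']; simp
  calc (1 - proj Q') * A * proj Q = (1 - proj Q') * (A * Q) * (Qᴴ * Q)⁻¹ * Qᴴ := by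
        unfold proj; simp only [Matrix.mul_assoc]
    _ = 0 := by rw [this]; simp

/-- An invariant column space: the compression is the matrix of the restriction. -/
theorem mul_eq_mul_compress {n m : ℕ} {A : Matrix (Fin n) (Fin n) ℂ}
    {Q : Matrix (Fin n) (Fin m) ℂ} (hQ : (Qᴴ * Q).det ≠ 0)
    (h : (1 - proj Q) * A * proj Q = 0) : A * Q = Q * compress A Q := by
  have h2 : (1 - proj Q) * A * Q = 0 := by
    calc (1 - proj Q) * A * Q = (1 - proj Q) * A * proj Q * Q := by
          rw [Matrix.mul_assoc _ (proj Q), proj_mul_self hQ]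
      _ = 0 := by rw [h, Matrix.zero_mul]
  rw [Matrix.sub_mul, Matrix.sub_mul, Matrix.one_mul, sub_eq_zero] at h2
  rw [h2]; unfold proj compress; simp only [Matrix.mul_assoc]

theorem compress_eq_of_mul_eq {n m : ℕ} {A : Matrix (Fin n) (Fin n) ℂ}
    {Q : Matrix (Fin n) (Fin m) ℂ} {S : Matrix (Fin m) (Fin m) ℂ} (hQ : (Qᴴ * Q).det ≠ 0)
    (h : A * Q = Q * S) : compress A Q = S := by
  unfold compress
  rw [Matrix.mul_assoc, h, Matrix.mul_assoc, ← Matrix.mul_assoc Qᴴ, ← Matrix.mul_assoc,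
    Matrix.nonsing_inv_mul _ hQ.isUnit, Matrix.one_mul]

theorem tendsto_matrix_inv {ι : Type*} {l : Filter ι} {m : ℕ} {A : ι → Matrix (Fin m) (Fin m) ℂ}
    {B : Matrix (Fin m) (Fin m) ℂ} (h : Tendsto A l (𝓝 B)) (hB : B.det ≠ 0) :
    Tendsto (fun k => (A k)⁻¹) l (𝓝 B⁻¹) := by
  simp only [Matrix.inv_def, Ring.inverse_eq_inv']
  have hd : Tendsto (fun k => (A k).det) l (𝓝 B.det) :=
    by
    have : Continuous fun X : Matrix (Fin m) (Fin m) ℂ => X.det := continuous_id.matrix_det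
    exact (this.tendsto B).comp h
  have ha : Tendsto (fun k => (A k).adjugate) l (𝓝 B.adjugate) :=
    by
    have : Continuous fun X : Matrix (Fin m) (Fin m) ℂ => X.adjugate :=
      continuous_id.matrix_adjugate
    exact (this.tendsto B).comp h
  exact (hd.inv₀ hB).smul ha

theorem tendsto_matrix_mul {ι : Type*} {l : Filter ι} {m p q : ℕ}
    {A : ι → Matrix (Fin m) (Fin p) ℂ} {A' : Matrix (Fin m) (Fin p) ℂ}
    {B : ι → Matrix (Fin p) (Fin q) ℂ} {B' : Matrix (Fin p) (Fin q) ℂ}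
    (hA : Tendsto A l (𝓝 A')) (hB : Tendsto B l (𝓝 B')) :
    Tendsto (fun k => A k * B k) l (𝓝 (A' * B')) := by
  have : Continuous fun x : Matrix (Fin m) (Fin p) ℂ × Matrix (Fin p) (Fin q) ℂ => x.1 * x.2 :=
    continuous_fst.matrix_mul continuous_snd
  have h := this.tendsto (A', B')
  rw [nhds_prod_eq] at h
  exact Tendsto.comp (f := fun k => (A k, B k)) (y := 𝓝 A' ×ˢ 𝓝 B') h (hA.prodMk hB)

theorem tendsto_conjTranspose {ι : Type*} {l : Filter ι} {m p : ℕ}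
    {A : ι → Matrix (Fin m) (Fin p) ℂ} {A' : Matrix (Fin m) (Fin p) ℂ}
    (hA : Tendsto A l (𝓝 A')) : Tendsto (fun k => (A k)ᴴ) l (𝓝 A'ᴴ) := by
  have : Continuous fun X : Matrix (Fin m) (Fin p) ℂ => Xᴴ := continuous_id.matrix_conjTranspose
  exact (this.tendsto A').comp hA

theorem tendsto_proj {ι : Type*} {l : Filter ι} {n m : ℕ} {Q : ι → Matrix (Fin n) (Fin m) ℂ}
    {Q' : Matrix (Fin n) (Fin m) ℂ} (h : Tendsto Q l (𝓝 Q')) (hQ' : (Q'ᴴ * Q').det ≠ 0) :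
    Tendsto (fun k => proj (Q k)) l (𝓝 (proj Q')) :=
  tendsto_matrix_mul (tendsto_matrix_mul h (tendsto_matrix_inv
    (tendsto_matrix_mul (tendsto_conjTranspose h) h) hQ')) (tendsto_conjTranspose h)

theorem tendsto_compress {ι : Type*} {l : Filter ι} {n m : ℕ} {A : Matrix (Fin n) (Fin n) ℂ}
    {Q : ι → Matrix (Fin n) (Fin m) ℂ}
    {Q' : Matrix (Fin n) (Fin m) ℂ} (h : Tendsto Q l (𝓝 Q')) (hQ' : (Q'ᴴ * Q').det ≠ 0) :
    Tendsto (fun k => compress A (Q k)) l (𝓝 (compress A Q')) :=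
  tendsto_matrix_mul (tendsto_matrix_mul (tendsto_matrix_mul (tendsto_matrix_inv
    (tendsto_matrix_mul (tendsto_conjTranspose h) h) hQ') (tendsto_conjTranspose h))
    tendsto_const_nhds) h

open scoped Matrix.Norms.L2Operator in
theorem tendsto_projDist {ι : Type*} {l : Filter ι} {n : ℕ} {P P' : ι → Matrix (Fin n) (Fin n) ℂ}
    {A : Matrix (Fin n) (Fin n) ℂ} (h : Tendsto P l (𝓝 A)) (h' : Tendsto P' l (𝓝 A)) :
    Tendsto (fun k => projDist (P k) (P' k)) l (𝓝 0) := by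
  simpa [projDist] using (h.sub h').norm

open scoped Matrix.Norms.L2Operator in
theorem tendsto_of_tendsto_projDist {ι : Type*} {l : Filter ι} {n : ℕ}
    {P P' : ι → Matrix (Fin n) (Fin n) ℂ} {A : Matrix (Fin n) (Fin n) ℂ}
    (h : Tendsto P l (𝓝 A)) (h' : Tendsto (fun k => projDist (P k) (P' k)) l (𝓝 0)) :
    Tendsto P' l (𝓝 A) := by
  have : Tendsto (fun k => P k - P' k) l (𝓝 0) := tendsto_zero_iff_norm_tendsto_zero.2 h'
  simpa using h.sub this

open scoped Matrix.Norms.L2Operator in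
theorem projDist_nonneg {n : ℕ} (P P' : Matrix (Fin n) (Fin n) ℂ) : 0 ≤ projDist P P' :=
  norm_nonneg _

open scoped Matrix.Norms.L2Operator in
theorem projDist_self {n : ℕ} (P : Matrix (Fin n) (Fin n) ℂ) : projDist P P = 0 := by
  rw [projDist, sub_self, norm_zero]

/-! ### Matrices with one or two columns -/

theorem oneCol_mulVec {n : ℕ} (x : EuclideanSpace ℂ (Fin n)) (c : Fin 1 → ℂ) :
    oneCol x *ᵥ c = c 0 • x.ofLp := by
  ext i; simp [oneCol, Matrix.mulVec, dotProduct, mul_comm]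

theorem twoCol_mulVec {n : ℕ} (x y : EuclideanSpace ℂ (Fin n)) (c : Fin 2 → ℂ) :
    twoCol x y *ᵥ c = c 0 • x.ofLp + c 1 • y.ofLp := by
  ext i; simp [twoCol, Matrix.mulVec, dotProduct, mul_comm, Fin.sum_univ_two]

theorem det_gram_oneCol {n : ℕ} {x : EuclideanSpace ℂ (Fin n)} (hx : x ≠ 0) :
    ((oneCol x)ᴴ * oneCol x).det ≠ 0 := by
  refine det_gram_ne_zero fun c hc => ?_
  rw [oneCol_mulVec, smul_eq_zero] at hc
  rcases hc with hc | hc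
  · ext i; fin_cases i; exact hc
  · exact absurd ((WithLp.ofLp_eq_zero 2).1 hc) hx

theorem det_gram_twoCol {n : ℕ} {x y : EuclideanSpace ℂ (Fin n)}
    (h : LinearIndependent ℂ ![x, y]) : ((twoCol x y)ᴴ * twoCol x y).det ≠ 0 := by
  refine det_gram_ne_zero fun c hc => ?_
  rw [twoCol_mulVec] at hc
  have := LinearIndependent.pair_iff.1 h (c 0) (c 1) ((WithLp.ofLp_eq_zero 2).1 hc)
  ext i; fin_cases i
  exacts [this.1, this.2]

theorem tendsto_oneCol {ι : Type*} {l : Filter ι} {n : ℕ} {x : ι → EuclideanSpace ℂ (Fin n)}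
    {x' : EuclideanSpace ℂ (Fin n)} (h : Tendsto x l (𝓝 x')) :
    Tendsto (fun k => oneCol (x k)) l (𝓝 (oneCol x')) := by
  have : Continuous fun x : EuclideanSpace ℂ (Fin n) => oneCol x :=
    continuous_matrix fun i j => by simp only [oneCol, Matrix.of_apply]; fun_prop
  exact (this.tendsto x').comp h

theorem tendsto_twoCol {ι : Type*} {l : Filter ι} {n : ℕ} {x y : ι → EuclideanSpace ℂ (Fin n)}
    {x' y' : EuclideanSpace ℂ (Fin n)} (h : Tendsto x l (𝓝 x')) (h' : Tendsto y l (𝓝 y')) :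
    Tendsto (fun k => twoCol (x k) (y k)) l (𝓝 (twoCol x' y')) := by
  have : Continuous fun p : EuclideanSpace ℂ (Fin n) × EuclideanSpace ℂ (Fin n) =>
      twoCol p.1 p.2 :=
    continuous_matrix fun i j => by
      fin_cases j <;> simp [twoCol] <;> fun_prop
  exact (this.tendsto (x', y')).comp (h.prodMk_nhds h')

theorem oneCol_smul {n : ℕ} (c : ℂ) (x : EuclideanSpace ℂ (Fin n)) :
    oneCol (c • x) = oneCol x * !![c] := by
  ext i j; fin_cases j; simp [oneCol, Matrix.mul_apply, mul_comm]

theorem twoCol_combination {n : ℕ} (x y : EuclideanSpace ℂ (Fin n)) (a b c d : ℂ) :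
    twoCol (a • x + b • y) (c • x + d • y) = twoCol x y * !![a, c; b, d] := by
  ext i j; fin_cases j <;> simp [twoCol, Matrix.mul_apply, mul_comm]

theorem proj_oneCol_smul {n : ℕ} {c : ℂ} (hc : c ≠ 0) (x : EuclideanSpace ℂ (Fin n)) :
    proj (oneCol (c • x)) = proj (oneCol x) := by
  rw [oneCol_smul]; exact proj_mul_right _ (by simpa using hc)

theorem mul_oneCol {n : ℕ} (A : Matrix (Fin n) (Fin n) ℂ) (x : EuclideanSpace ℂ (Fin n)) :
    A * oneCol x = oneCol (apply A x) := by
  ext i j; simp [oneCol, apply, Matrix.mul_apply, Matrix.mulVec, dotProduct]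

theorem mul_twoCol {n : ℕ} (A : Matrix (Fin n) (Fin n) ℂ) (x y : EuclideanSpace ℂ (Fin n)) :
    A * twoCol x y = twoCol (apply A x) (apply A y) := by
  ext i j; fin_cases j <;> simp [twoCol, apply, Matrix.mul_apply, Matrix.mulVec, dotProduct]

/-! ### Asymptotics of powers on generalized eigenspaces -/

theorem tendsto_zero_of_le_mul_add {a e : ℕ → ℝ} {q : ℝ} (hq0 : 0 ≤ q) (hq : q < 1)
    (ha : ∀ k, 0 ≤ a k) (h : ∀ k, a (k + 1) ≤ q * a k + e k) (he : Tendsto e atTop (𝓝 0)) :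
    Tendsto a atTop (𝓝 0) := by
  rw [Metric.tendsto_atTop]
  intro ε hε
  -- This bound on e reproduces ε / 2 under the recursion: q·ε/2 + (1 - q)·ε/2 = ε/2.
  have h1 : 0 < ε / 2 * (1 - q) := by
    have : 0 < 1 - q := by linarith
    positivity
  obtain ⟨K, hK⟩ := eventually_atTop.1 (he.eventually_lt_const h1)
  have h2 : ∀ j, a (K + j) ≤ q ^ j * a K + ε / 2 := by
    intro j
    induction j with
    | zero => simp; linarith
    | succ j ih =>
      have h3 := h (K + j)
      have h4 := hK (K + j) (by omega)
      have h5 := mul_le_mul_of_nonneg_left ih hq0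
      rw [← add_assoc, pow_succ]
      nlinarith
  have h6 : Tendsto (fun j => q ^ j * a K) atTop (𝓝 0) := by
    simpa using (tendsto_pow_atTop_nhds_zero_of_lt_one hq0 hq).mul_const (a K)
  obtain ⟨J, hJ⟩ := eventually_atTop.1 (h6.eventually_lt_const (half_pos hε))
  refine ⟨K + J, fun k hk => ?_⟩
  obtain ⟨j, rfl⟩ := Nat.exists_eq_add_of_le (show K ≤ k by omega)
  have := h2 j
  have := hJ j (by omega)
  rw [Real.dist_0_eq_abs, abs_of_nonneg (ha _)]
  linarith

section Powers

variable {V : Type*} [NormedAddCommGroup V] [NormedSpace ℂ V]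

/-- Induction on the nilpotency order: z = (f - ν)y has smaller order, and f y = ν y + z turns the
scaled norms into a contraction with ratio ‖ν‖/‖lam‖ and vanishing perturbation. No Jordan form is
needed. -/
theorem tendsto_inv_pow_smul_of_pow_eq_zero (f : Module.End ℂ V) {lam ν : ℂ} (h : ‖ν‖ < ‖lam‖)
    (N : ℕ) (y : V) (hy : ((f - ν • (1 : Module.End ℂ V)) ^ N) y = 0) :
    Tendsto (fun k => (lam ^ k)⁻¹ • (f ^ k) y) atTop (𝓝 0) := by
  have hlam : 0 < ‖lam‖ := (norm_nonneg _).trans_lt h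
  have hlam0 : lam ≠ 0 := norm_pos_iff.1 hlam
  induction N generalizing y with
  | zero => simp only [pow_zero, Module.End.one_apply] at hy; simp [hy]
  | succ N ih =>
    have hz := ih ((f - ν • (1 : Module.End ℂ V)) y) (by rwa [pow_succ] at hy)
    set z := (f - ν • (1 : Module.End ℂ V)) y with hzdef
    have hfy : f y = ν • y + z := by simp [hzdef]
    rw [tendsto_zero_iff_norm_tendsto_zero] at hz ⊢
    refine tendsto_zero_of_le_mul_add (q := ‖ν‖ / ‖lam‖)
      (e := fun k => ‖lam‖⁻¹ * ‖(lam ^ k)⁻¹ • (f ^ k) z‖) (by positivity)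
      ((div_lt_one hlam).2 h) (fun _ => norm_nonneg _) (fun k => ?_) ?_
    · have : (lam ^ (k + 1))⁻¹ • (f ^ (k + 1)) y
          = (ν / lam) • ((lam ^ k)⁻¹ • (f ^ k) y) + lam⁻¹ • ((lam ^ k)⁻¹ • (f ^ k) z) := by
        rw [pow_succ f, Module.End.mul_apply, hfy, map_add, map_smul, smul_add, smul_smul,
          smul_smul, smul_smul, pow_succ]
        congr 2 <;> field_simp
      rw [this]
      refine (norm_add_le _ _).trans ?_
      rw [norm_smul, norm_smul lam⁻¹, norm_div, norm_inv]
    · simpa using hz.const_mul ‖lam‖⁻¹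

theorem tendsto_inv_pow_smul_of_mem_iSup (f : Module.End ℂ V) {lam : ℂ} {S : Set ℂ}
    (hS : ∀ ν ∈ S, f.HasEigenvalue ν → ‖ν‖ < ‖lam‖) {y : V}
    (hy : y ∈ ⨆ ν ∈ S, f.maxGenEigenspace ν) :
    Tendsto (fun k => (lam ^ k)⁻¹ • (f ^ k) y) atTop (𝓝 0) := by
  let W : Submodule ℂ V :=
    { carrier := {y | Tendsto (fun k => (lam ^ k)⁻¹ • (f ^ k) y) atTop (𝓝 0)}
      zero_mem' := by simp
      add_mem' := fun {a b} ha hb => by simpa using Tendsto.add ha hb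
      smul_mem' := fun c a ha => by
        simpa [smul_comm c] using Tendsto.const_smul ha c }
  suffices h : (⨆ ν ∈ S, f.maxGenEigenspace ν) ≤ W from h hy
  refine iSup₂_le fun ν hν y hy => ?_
  obtain ⟨N, hN⟩ := (Module.End.mem_maxGenEigenspace f ν y).1 hy
  -- The supremum also runs over non-eigenvalues, whose generalized eigenspaces are zero.
  by_cases he : f.HasEigenvalue ν
  · exact tendsto_inv_pow_smul_of_pow_eq_zero f (hS ν hν he) N y hN
  · have hker : LinearMap.ker (f - ν • (1 : Module.End ℂ V)) = ⊥ := by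
      by_contra hne
      apply he
      rwa [Module.End.hasEigenvalue_iff, Module.End.eigenspace_def]
    have hinj : Function.Injective (f - ν • (1 : Module.End ℂ V)) := LinearMap.ker_eq_bot.1 hker
    have : y = 0 := by
      have h2 : Function.Injective ((f - ν • (1 : Module.End ℂ V)) ^ N) := by
        rw [Module.End.coe_pow]; exact hinj.iterate N
      exact h2 (by rw [hN, map_zero])
    rw [this]; exact W.zero_mem

theorem pow_apply_of_eigen {f : Module.End ℂ V} {lam : ℂ} {u : V} (hu : f u = lam • u) (k : ℕ) :
    (f ^ k) u = lam ^ k • u := by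
  induction k with
  | zero => simp
  | succ k ih => rw [pow_succ, Module.End.mul_apply, hu, map_smul, ih, smul_smul, pow_succ, mul_comm]

variable [FiniteDimensional ℂ V]

/-- Algebraic multiplicity is the dimension of the maximal generalized eigenspace, here a line. -/
theorem maxGenEigenspace_le_span {f : Module.End ℂ V} {lam : ℂ}
    (h : f.charpoly.rootMultiplicity lam = 1) {u : V} (hu : u ∈ f.maxGenEigenspace lam)
    (hu0 : u ≠ 0) : ∀ x ∈ f.maxGenEigenspace lam, ∃ c : ℂ, c • u = x := by
  rw [← LinearMap.finrank_maxGenEigenspace_eq] at h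
  intro x hx
  obtain ⟨c, hc⟩ := (finrank_eq_one_iff_of_nonzero' (⟨u, hu⟩ : f.maxGenEigenspace lam)
    (by simpa [Subtype.ext_iff] using hu0)).1 h ⟨x, hx⟩
  exact ⟨c, by simpa using congrArg Subtype.val hc⟩

theorem apply_eq_of_mem_maxGenEigenspace {f : Module.End ℂ V} {lam : ℂ}
    (h : f.charpoly.rootMultiplicity lam = 1) {x : V} (hx : x ∈ f.maxGenEigenspace lam) :
    f x = lam • x := by
  have hroot : f.charpoly.IsRoot lam := by
    have h0 : f.charpoly ≠ 0 := f.charpoly_monic.ne_zero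
    exact (Polynomial.rootMultiplicity_pos h0).1 (by omega)
  have he : f.HasEigenvalue lam := (Module.End.hasEigenvalue_iff_isRoot_charpoly f lam).2 hroot
  obtain ⟨u, hu⟩ := he.exists_hasEigenvector
  obtain ⟨c, rfl⟩ := maxGenEigenspace_le_span h
    (Module.End.eigenspace_le_maxGenEigenspace hu.1) hu.2 x hx
  rw [map_smul, hu.apply_eq_smul, smul_comm]

theorem exists_component {f : Module.End ℂ V} {lam : ℂ}
    (h : f.charpoly.rootMultiplicity lam = 1) {x : V}
    (hx : x ∉ ⨆ ν ∈ {ν : ℂ | ν ≠ lam}, f.maxGenEigenspace ν) :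
    ∃ u y, u ≠ 0 ∧ f u = lam • u ∧ y ∈ (⨆ ν ∈ {ν : ℂ | ν ≠ lam}, f.maxGenEigenspace ν) ∧
      x = u + y := by
  have htop : x ∈ f.maxGenEigenspace lam ⊔ ⨆ ν ∈ {ν : ℂ | ν ≠ lam}, f.maxGenEigenspace ν := by
    have := iSup_split_single (fun ν => f.maxGenEigenspace ν) lam
    rw [Module.End.iSup_maxGenEigenspace_eq_top] at this
    exact this ▸ Submodule.mem_top
  obtain ⟨u, hu, y, hy, rfl⟩ := Submodule.mem_sup.1 htop
  refine ⟨u, y, ?_, apply_eq_of_mem_maxGenEigenspace h hu, hy, rfl⟩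
  rintro rfl
  exact hx (by simpa using hy)

/-- Since ν is simple, f - ν annihilates its whole generalized eigenspace; it preserves all others
because it commutes with f. -/
theorem sub_smul_apply_mem {f : Module.End ℂ V} {lam ν : ℂ}
    (h : f.charpoly.rootMultiplicity ν = 1) {y : V}
    (hy : y ∈ ⨆ κ ∈ {κ : ℂ | κ ≠ lam}, f.maxGenEigenspace κ) :
    f y - ν • y ∈ ⨆ κ ∈ {κ : ℂ | κ ≠ lam ∧ κ ≠ ν}, f.maxGenEigenspace κ := by
  suffices h2 : (⨆ κ ∈ {κ : ℂ | κ ≠ lam}, f.maxGenEigenspace κ) ≤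
      (⨆ κ ∈ {κ : ℂ | κ ≠ lam ∧ κ ≠ ν}, f.maxGenEigenspace κ).comap
        (f - ν • (1 : Module.End ℂ V)) by
    simpa using h2 hy
  refine iSup₂_le fun κ hκ z hz => ?_
  rw [Submodule.mem_comap]
  by_cases hκν : κ = ν
  · subst hκν
    have := apply_eq_of_mem_maxGenEigenspace h hz
    simp [this]
  · have h3 : (f - ν • (1 : Module.End ℂ V)) z ∈ f.maxGenEigenspace κ := by
      have hc : Commute f (f - ν • (1 : Module.End ℂ V)) :=
        (Commute.refl f).sub_right ((Commute.one_right f).smul_right ν)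
      exact Module.End.mapsTo_maxGenEigenspace_of_comm hc κ hz
    exact Submodule.mem_iSup_of_mem κ (Submodule.mem_iSup_of_mem ⟨hκ, hκν⟩ h3)

/-- Powers of an endomorphism with a single dominant eigenvalue. -/
theorem tendsto_pow_apply_single {f : Module.End ℂ V} {lam : ℂ}
    (h : f.charpoly.rootMultiplicity lam = 1) (hlam : lam ≠ 0)
    (hdom : ∀ ν, f.HasEigenvalue ν → ν ≠ lam → ‖ν‖ < ‖lam‖) {x : V}
    (hx : x ∉ ⨆ ν ∈ {ν : ℂ | ν ≠ lam}, f.maxGenEigenspace ν) :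
    ∃ u, u ≠ 0 ∧ f u = lam • u ∧ Tendsto (fun k => (lam ^ k)⁻¹ • (f ^ k) x) atTop (𝓝 u) := by
  obtain ⟨u, y, hu0, hu, hy, rfl⟩ := exists_component h hx
  refine ⟨u, hu0, hu, ?_⟩
  have := tendsto_inv_pow_smul_of_mem_iSup f (lam := lam) (fun ν hν he => hdom ν he hν) hy
  have h2 := this.const_add u
  rw [add_zero] at h2
  refine h2.congr fun k => ?_
  rw [map_add, smul_add, pow_apply_of_eigen hu, inv_smul_smul₀ (pow_ne_zero k hlam)]

/-- Powers of an endomorphism with two dominant eigenvalues. -/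
theorem tendsto_pow_apply_pair {f : Module.End ℂ V} {lam ν : ℂ}
    (h : f.charpoly.rootMultiplicity lam = 1) (h' : f.charpoly.rootMultiplicity ν = 1)
    (hlam : lam ≠ 0) (hne : lam ≠ ν)
    (hdom : ∀ κ, f.HasEigenvalue κ → κ ≠ lam → κ ≠ ν → ‖κ‖ < ‖lam‖) {x : V}
    (hx : x ∉ ⨆ ν ∈ {ν : ℂ | ν ≠ lam}, f.maxGenEigenspace ν) :
    ∃ u, u ≠ 0 ∧ f u = lam • u ∧
      Tendsto (fun k => (lam ^ k)⁻¹ • ((f ^ (k + 1)) x - ν • (f ^ k) x)) atTop (𝓝 u) := by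
  obtain ⟨u, y, hu0, hu, hy, rfl⟩ := exists_component h hx
  -- Applying f - ν, which removes the second dominant component, multiplies the lam-component by
  -- lam - ν.
  refine ⟨(lam - ν) • u, smul_ne_zero (sub_ne_zero.2 hne) hu0, by rw [map_smul, hu, smul_comm], ?_⟩
  have := tendsto_inv_pow_smul_of_mem_iSup f (lam := lam) (S := {κ : ℂ | κ ≠ lam ∧ κ ≠ ν})
    (fun κ hκ he => hdom κ he hκ.1 hκ.2) (sub_smul_apply_mem h' hy)
  have h2 := this.const_add ((lam - ν) • u)
  rw [add_zero] at h2
  refine h2.congr fun k => ?_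
  have hl := pow_ne_zero k hlam
  rw [map_add, map_add, pow_apply_of_eigen hu, pow_apply_of_eigen hu, map_sub, map_smul,
    ← Module.End.mul_apply, ← pow_succ]
  have : (lam - ν) • u = (lam ^ k)⁻¹ • (lam ^ (k + 1) • u - ν • lam ^ k • u) := by
    rw [smul_sub, smul_smul, smul_smul, smul_smul, ← sub_smul]
    congr 1
    field_simp
    ring
  rw [this]
  module

end Powers

/-! ### The eigenvalue of a `2 × 2` matrix given by the principal square root -/

/-- The discriminant tends to ((a - b)/2)², and (a - b)/2 lies in the open right half plane. So the
principal root is continuous at the limit and equals (a - b)/2 there. -/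
theorem tendsto_eigAbs_of_re_lt {ι : Type*} {l : Filter ι} {R : ι → Matrix (Fin 2) (Fin 2) ℂ}
    {R' : Matrix (Fin 2) (Fin 2) ℂ} (h : Tendsto R l (𝓝 R')) {a b : ℂ} (htr : R'.trace = a + b)
    (hdet : R'.det = a * b) (hab : b.re < a.re) :
    Tendsto (fun k => eigAbs (R k)) l (𝓝 ‖a‖) := by
  have hz : 0 < ((a - b) / 2).re := by
    have : ((a - b) / 2).re = (a.re - b.re) / 2 := by simp
    rw [this]; linarith
  have hD : (R'.trace / 2) ^ 2 - R'.det = ((a - b) / 2) ^ 2 := by rw [htr, hdet]; ring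
  have hslit : ((a - b) / 2) ^ 2 ∈ Complex.slitPlane := by
    generalize (a - b) / 2 = z at hz
    rw [Complex.mem_slitPlane_iff]
    by_cases hi : z.im = 0
    · left; simp [sq, hi]; exact hz.ne'
    · right; simp only [sq, Complex.mul_im]
      have := mul_ne_zero hz.ne' hi
      intro h0; apply this; linarith
  have htr' : Tendsto (fun k => (R k).trace) l (𝓝 R'.trace) := by
    have : Continuous fun X : Matrix (Fin 2) (Fin 2) ℂ => X.trace := continuous_id.matrix_trace
    exact (this.tendsto R').comp h
  have hdet' : Tendsto (fun k => (R k).det) l (𝓝 R'.det) := by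
    have : Continuous fun X : Matrix (Fin 2) (Fin 2) ℂ => X.det := continuous_id.matrix_det
    exact (this.tendsto R').comp h
  have hlim := ((htr'.div_const 2).add
    (((htr'.div_const 2).pow 2).sub hdet' |>.cpow tendsto_const_nhds
      (b := (1 / 2 : ℂ)) (by rw [hD]; exact hslit))).norm
  have hval : R'.trace / 2 + ((R'.trace / 2) ^ 2 - R'.det) ^ (1 / 2 : ℂ) = a := by
    rw [hD, one_div, Complex.sq_cpow_two_inv hz, htr]; ring
  rw [hval] at hlim
  exact hlim

/-- Here the limiting discriminant is -(Im a)², where the principal root may jump between branches.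
Along any ultrafilter the roots still converge to some square root, and both choices give an
eigenvalue of modulus ‖a‖. -/
theorem tendsto_eigAbs_of_conj {ι : Type*} {l : Filter ι} {R : ι → Matrix (Fin 2) (Fin 2) ℂ}
    {R' : Matrix (Fin 2) (Fin 2) ℂ} (h : Tendsto R l (𝓝 R')) {a : ℂ}
    (htr : R'.trace = conj a + a) (hdet : R'.det = conj a * a) :
    Tendsto (fun k => eigAbs (R k)) l (𝓝 ‖a‖) := by
  rw [tendsto_iff_ultrafilter]
  intro U hU
  replace h := h.mono_left hU
  have htr' : Tendsto (fun k => (R k).trace) U (𝓝 R'.trace) := by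
    have : Continuous fun X : Matrix (Fin 2) (Fin 2) ℂ => X.trace := continuous_id.matrix_trace
    exact (this.tendsto R').comp h
  have hdet' : Tendsto (fun k => (R k).det) U (𝓝 R'.det) := by
    have : Continuous fun X : Matrix (Fin 2) (Fin 2) ℂ => X.det := continuous_id.matrix_det
    exact (this.tendsto R').comp h
  have hD := ((htr'.div_const 2).pow 2).sub hdet'
  set s : ι → ℂ := fun k => (((R k).trace / 2) ^ 2 - (R k).det) ^ (1 / 2 : ℂ) with hs
  have hs2 : ∀ k, s k ^ 2 = ((R k).trace / 2) ^ 2 - (R k).det := fun k => by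
    rw [hs]
    simp
  set D := (R'.trace / 2) ^ 2 - R'.det with hDdef
  have hbd : ∀ᶠ k in (U : Filter ι), s k ∈ Metric.closedBall (0 : ℂ) (‖D‖ + 1) := by
    have := hD.norm.eventually_lt_const (show ‖D‖ < ‖D‖ + 1 by linarith)
    filter_upwards [this] with k hk
    rw [← hs2, norm_pow] at hk
    rw [mem_closedBall_zero_iff]
    nlinarith [norm_nonneg (s k), norm_nonneg D]
  obtain ⟨t, -, ht⟩ := (isCompact_closedBall (0 : ℂ) (‖D‖ + 1)).ultrafilter_le_nhds
    (U.map s) (le_principal_iff.2 hbd)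
  have ht' : Tendsto s U (𝓝 t) := ht
  have ht2 : t ^ 2 = D := by
    refine tendsto_nhds_unique (ht'.pow 2) ?_
    simpa only [hs2] using hD
  -- The product is the limiting characteristic polynomial evaluated at tr/2 + t.
  have hfac : (R'.trace / 2 + t - a) * (R'.trace / 2 + t - conj a) = 0 := by
    have : (R'.trace / 2 + t - a) * (R'.trace / 2 + t - conj a) = t ^ 2 - D
      + (R'.trace - (conj a + a)) * (R'.trace / 2 + t) - (R'.det - conj a * a) := by
      rw [hDdef]; ring
    rw [this, ht2, htr, hdet]; ring
  have hval : ‖R'.trace / 2 + t‖ = ‖a‖ := by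
    rcases mul_eq_zero.1 hfac with h0 | h0
    · rw [sub_eq_zero.1 h0]
    · rw [sub_eq_zero.1 h0, Complex.norm_conj]
  rw [← hval]
  exact ((htr'.div_const 2).add ht').norm

theorem det_gram_of_mul {n m : ℕ} {Q : Matrix (Fin n) (Fin m) ℂ} {T : Matrix (Fin m) (Fin m) ℂ}
    (h : ((Q * T)ᴴ * (Q * T)).det ≠ 0) : (Qᴴ * Q).det ≠ 0 := by
  intro h0
  apply h
  have e : (Q * T)ᴴ * (Q * T) = Tᴴ * ((Qᴴ * Q) * T) := by
    rw [Matrix.conjTranspose_mul]; simp only [Matrix.mul_assoc]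
  rw [e, Matrix.det_mul, Matrix.det_mul, h0]; ring

/-! ### The state vectors -/

section State

variable {n : ℕ} (M : Matrix (Fin n) (Fin n) ℂ)

/-- The unnormalized iterates `M ^ k x`. -/
noncomputable def iter (x : EuclideanSpace ℂ (Fin n)) (k : ℕ) : EuclideanSpace ℂ (Fin n) :=
  WithLp.toLp 2 ((Matrix.toLin' M ^ k) x.ofLp)

theorem apply_smul (c : ℂ) (x : EuclideanSpace ℂ (Fin n)) : apply M (c • x) = c • apply M x := by
  simp [apply, Matrix.mulVec_smul]

theorem apply_real_smul (c : ℝ) (x : EuclideanSpace ℂ (Fin n)) :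
    apply M (c • x) = c • apply M x := by
  simp [apply, Matrix.mulVec_smul]

theorem apply_iter (x : EuclideanSpace ℂ (Fin n)) (k : ℕ) :
    apply M (iter M x k) = iter M x (k + 1) := by
  simp [apply, iter, pow_succ']

theorem apply_eq_smul_iff {v : EuclideanSpace ℂ (Fin n)} {lam : ℂ} :
    apply M v = lam • v ↔ Matrix.toLin' M v.ofLp = lam • v.ofLp := by
  constructor
  · intro h; simpa [apply] using congrArg WithLp.ofLp h
  · intro h; rw [Matrix.toLin'_apply] at h; simp [apply, h]

variable {M}

/-- A vector killed by a power of M lies in the generalized eigenspace of 0, hence has no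
lam-component. -/
theorem iter_ne_zero {lam : ℂ} (hlam : lam ≠ 0) {x : EuclideanSpace ℂ (Fin n)}
    (hx : HasSpectralComponent M lam x) (k : ℕ) : iter M x k ≠ 0 := by
  intro h
  apply hx
  refine Submodule.mem_iSup_of_mem 0 (Submodule.mem_iSup_of_mem hlam.symm ?_)
  rw [Module.End.mem_maxGenEigenspace]
  exact ⟨k, by simpa [iter] using h⟩

theorem state_eq {x : EuclideanSpace ℂ (Fin n)} (hx : ‖x‖ = 1) (h : ∀ k, iter M x k ≠ 0)
    (k : ℕ) : state M x k = ‖iter M x k‖⁻¹ • iter M x k := by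
  induction k with
  | zero => simp [state, iter, hx]
  | succ k ih =>
    have h0 : 0 < ‖iter M x k‖ := norm_pos_iff.2 (h k)
    rw [state, ih, apply_real_smul, apply_iter, norm_smul, smul_smul, norm_inv, norm_norm]
    congr 1
    field_simp

theorem norm_state {x : EuclideanSpace ℂ (Fin n)} (hx : ‖x‖ = 1) (h : ∀ k, iter M x k ≠ 0)
    (k : ℕ) : ‖state M x k‖ = 1 := by
  rw [state_eq hx h, norm_smul, norm_inv, norm_norm, inv_mul_cancel₀ (norm_ne_zero_iff.2 (h k))]

theorem apply_state_ne_zero {x : EuclideanSpace ℂ (Fin n)} (hx : ‖x‖ = 1)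
    (h : ∀ k, iter M x k ≠ 0) (k : ℕ) : apply M (state M x k) ≠ 0 := by
  rw [state_eq hx h, apply_real_smul, apply_iter]
  exact smul_ne_zero (inv_ne_zero (norm_ne_zero_iff.2 (h k))) (h (k + 1))

theorem apply_state_eq {x : EuclideanSpace ℂ (Fin n)} (hx : ‖x‖ = 1)
    (h : ∀ k, iter M x k ≠ 0) (k : ℕ) :
    apply M (state M x k) = (‖apply M (state M x k)‖ : ℂ) • state M x (k + 1) := by
  have h1 := norm_ne_zero_iff.2 (apply_state_ne_zero hx h k)
  have h2 : ((‖apply M (state M x k)‖ : ℝ) : ℂ) ≠ 0 := by exact_mod_cast h1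
  conv_rhs => rw [state]
  rw [← Complex.coe_smul, smul_smul, Complex.ofReal_inv, mul_inv_cancel₀ h2, one_smul]

theorem one_sub_projOne_mul_mul_projOne {x : EuclideanSpace ℂ (Fin n)} (hx : ‖x‖ = 1)
    (h : ∀ k, iter M x k ≠ 0) (k : ℕ) :
    (1 - projOne M x (k + 1)) * M * projOne M x k = 0 := by
  cases k with
  | zero => simp [projOne]
  | succ k =>
    refine one_sub_proj_mul_mul_proj (S := !![(‖apply M (state M x (k + 1))‖ : ℂ)])
      (det_gram_oneCol ?_) ?_
    · rw [← norm_ne_zero_iff, norm_state hx h]; exact one_ne_zero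
    · rw [mul_oneCol, ← oneCol_smul, ← apply_state_eq hx h]

/-- M sends each of the two columns to a multiple of the next state. For k = 0 the claim is trivial
because the initial projection is 0. -/
theorem one_sub_projTwo_mul_mul_projTwo {x : EuclideanSpace ℂ (Fin n)} (hx : ‖x‖ = 1)
    (h : ∀ k, iter M x k ≠ 0) (k : ℕ)
    (hk : ((twoCol (state M x k) (state M x (k + 1)))ᴴ *
      twoCol (state M x k) (state M x (k + 1))).det ≠ 0) :
    (1 - projTwo M x (k + 1)) * M * projTwo M x k = 0 := by
  cases k with
  | zero => simp [projTwo]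
  | succ k =>
    refine one_sub_proj_mul_mul_proj (S := !![(‖apply M (state M x k)‖ : ℂ), 0;
      0, (‖apply M (state M x (k + 1))‖ : ℂ)]) hk ?_
    rw [mul_twoCol, ← twoCol_combination, zero_smul, zero_smul, add_zero, zero_add,
      ← apply_state_eq hx h, ← apply_state_eq hx h (k + 1)]

end State

/-! ### Eigenvalues and simple eigenlines of a complex matrix. -/

section Convergence

variable {n : ℕ} {M : Matrix (Fin n) (Fin n) ℂ}

theorem hasEigenvalue_toLin'_iff {ν : ℂ} :
    Module.End.HasEigenvalue (Matrix.toLin' M) ν ↔ ν ∈ spectrum ℂ M := by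
  rw [Module.End.hasEigenvalue_iff_mem_spectrum, Matrix.spectrum_toLin']

theorem mem_spectrum_of_apply {v : EuclideanSpace ℂ (Fin n)} (hv : v ≠ 0) {ν : ℂ}
    (h : apply M v = ν • v) : ν ∈ spectrum ℂ M := by
  rw [← hasEigenvalue_toLin'_iff]
  refine Module.End.hasEigenvalue_of_hasEigenvector (x := v.ofLp) ⟨?_, ?_⟩
  · rw [Module.End.mem_eigenspace_iff]; exact (apply_eq_smul_iff M).1 h
  · rwa [Ne, WithLp.ofLp_eq_zero]

/-- The eigenspace of a simple eigenvalue is a line, even among generalized eigenvectors. -/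
theorem exists_smul_eq_of_simple {lam : ℂ} (h : M.charpoly.rootMultiplicity lam = 1)
    {u v : EuclideanSpace ℂ (Fin n)} (hu0 : u ≠ 0) (hu : apply M u = lam • u) (c : ℂ)
    (hv : apply M v = lam • v + c • u) : ∃ b : ℂ, v = b • u := by
  have hu' := (apply_eq_smul_iff M).1 hu
  have hv' : Matrix.toLin' M v.ofLp = lam • v.ofLp + c • u.ofLp := by
    simpa [apply] using congrArg WithLp.ofLp hv
  rw [← Matrix.charpoly_toLin'] at h
  have hmu : u.ofLp ∈ Module.End.maxGenEigenspace (Matrix.toLin' M) lam :=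
    Module.End.eigenspace_le_maxGenEigenspace (Module.End.mem_eigenspace_iff.2 hu')
  have hmv : v.ofLp ∈ Module.End.maxGenEigenspace (Matrix.toLin' M) lam := by
    rw [Module.End.mem_maxGenEigenspace]
    refine ⟨2, ?_⟩
    rw [sq, Module.End.mul_apply]
    simp only [LinearMap.sub_apply, LinearMap.smul_apply, Module.End.one_apply, hv',
      add_sub_cancel_left, map_smul, hu']
    rw [sub_self, smul_zero]
  obtain ⟨b, hb⟩ := maxGenEigenspace_le_span h hmu (by rwa [Ne, WithLp.ofLp_eq_zero]) _ hmv
  exact ⟨b, by rw [← WithLp.toLp_ofLp 2 v, ← hb]; rfl⟩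

/-! ### A real dominant eigenvalue -/

/-- Positivity of lam is what makes the states themselves converge: normalization then divides out a
positive factor lam ^ k, with no alternating sign left over. -/
theorem exists_tendsto_state {lam : ℂ} (him : lam.im = 0) (hre : 0 < lam.re)
    (hlam : IsSimpleDominant M lam) {x₀ : EuclideanSpace ℂ (Fin n)} (hx₀ : ‖x₀‖ = 1)
    (hx : HasSpectralComponent M lam x₀) :
    ∃ e, ‖e‖ = 1 ∧ apply M e = lam • e ∧ Tendsto (state M x₀) atTop (𝓝 e) := by
  have hlam0 : lam ≠ 0 := fun h => by simp [h] at hre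
  have hiter := iter_ne_zero hlam0 hx
  obtain ⟨u, hu0, hu, hlim⟩ := tendsto_pow_apply_single (f := Matrix.toLin' M) (lam := lam)
    (by rw [Matrix.charpoly_toLin']; exact hlam.1) hlam0
    (fun ν hν hne => hlam.2 ν (hasEigenvalue_toLin'_iff.1 hν) hne (by
      rwa [Complex.conj_eq_iff_im.2 him])) hx
  obtain ⟨r, rfl⟩ : ∃ r : ℝ, lam = r := ⟨lam.re, by apply Complex.ext <;> simp [him]⟩
  have hr : 0 < r := by simpa using hre
  set u' : EuclideanSpace ℂ (Fin n) := WithLp.toLp 2 u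
  have hu'0 : u' ≠ 0 := by
    intro h0; exact hu0 ((WithLp.toLp_eq_zero 2).1 h0)
  have hMu : apply M u' = (r : ℂ) • u' := (apply_eq_smul_iff M).2 hu
  have hlim' : Tendsto (fun k => ((r ^ k)⁻¹ : ℝ) • iter M x₀ k) atTop (𝓝 u') := by
    have := ((PiLp.continuous_toLp 2 (fun _ : Fin n => ℂ)).tendsto u).comp hlim
    refine this.congr fun k => ?_
    ext i
    simp [iter]
  have hn : ‖u'‖ ≠ 0 := norm_ne_zero_iff.2 hu'0
  refine ⟨‖u'‖⁻¹ • u', ?_, ?_, ?_⟩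
  · rw [norm_smul, norm_inv, norm_norm, inv_mul_cancel₀ hn]
  · rw [apply_real_smul, hMu, smul_comm]
  · refine ((hlim'.norm.inv₀ hn).smul hlim').congr fun k => ?_
    have h0 := norm_ne_zero_iff.2 (hiter k)
    rw [state_eq hx₀ hiter, norm_smul, smul_smul, Real.norm_of_nonneg (by positivity)]
    congr 1
    have : r ^ k ≠ 0 := by positivity
    field_simp

theorem compress_oneCol_of_eigen {e : EuclideanSpace ℂ (Fin n)} (he : e ≠ 0) {lam : ℂ}
    (h : apply M e = lam • e) : compress M (oneCol e) = !![lam] :=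
  compress_eq_of_mul_eq (det_gram_oneCol he) (by rw [mul_oneCol, h, oneCol_smul])

theorem tendsto_entry {ι : Type*} {l : Filter ι} {m p : ℕ}
    {A : ι → Matrix (Fin m) (Fin p) ℂ} {A' : Matrix (Fin m) (Fin p) ℂ}
    (hA : Tendsto A l (𝓝 A')) (i : Fin m) (j : Fin p) :
    Tendsto (fun k => A k i j) l (𝓝 (A' i j)) := by
  have : Continuous fun X : Matrix (Fin m) (Fin p) ℂ => X i j := continuous_id.matrix_elem i j
  exact (this.tendsto A').comp hA

theorem tendsto_projOne {x₀ e : EuclideanSpace ℂ (Fin n)} (he : e ≠ 0)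
    (hlim : Tendsto (state M x₀) atTop (𝓝 e)) :
    Tendsto (projOne M x₀) atTop (𝓝 (proj (oneCol e))) := by
  rw [← tendsto_add_atTop_iff_nat 1]
  exact tendsto_proj (tendsto_oneCol ((tendsto_add_atTop_iff_nat 1).2 hlim)) (det_gram_oneCol he)

theorem tendsto_lamOne {x₀ e : EuclideanSpace ℂ (Fin n)} (he : e ≠ 0) {lam : ℂ}
    (hMe : apply M e = lam • e) (hlim : Tendsto (state M x₀) atTop (𝓝 e)) :
    Tendsto (lamOne M x₀) atTop (𝓝 ‖lam‖) := by
  have h := tendsto_compress (A := M) (tendsto_oneCol ((tendsto_add_atTop_iff_nat 1).2 hlim))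
    (det_gram_oneCol he)
  rw [compress_oneCol_of_eigen he hMe] at h
  exact (tendsto_entry h 0 0).norm

theorem linearIndependent_of_inner_eq_zero {e y : EuclideanSpace ℂ (Fin n)} (he : ‖e‖ = 1)
    (hy : ‖y‖ = 1) (h : inner ℂ e y = 0) : LinearIndependent ℂ ![e, y] := by
  have : Orthonormal ℂ ![e, y] := by
    rw [orthonormal_iff_ite]
    have h' : inner ℂ y e = 0 := inner_eq_zero_symm.1 h
    intro i j
    fin_cases i <;> fin_cases j <;> simp [he, hy, h, h', inner_self_eq_norm_sq_to_K]
  exact this.linearIndependent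

/-- The remaining eigenvalue of a matrix on an invariant plane through a simple dominant
eigenvector. -/
theorem exists_trace_det_compress {lam : ℂ} (him : lam.im = 0) (hre : 0 < lam.re)
    (hlam : IsSimpleDominant M lam) {e y : EuclideanSpace ℂ (Fin n)}
    (hey : LinearIndependent ℂ ![e, y]) (hMe : apply M e = lam • e)
    (hinv : (1 - proj (twoCol e y)) * M * proj (twoCol e y) = 0) :
    ∃ μ : ℂ, (compress M (twoCol e y)).trace = lam + μ ∧
      (compress M (twoCol e y)).det = lam * μ ∧ μ.re < lam.re := by
  have he : e ≠ 0 := hey.ne_zero 0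
  have hMQ := mul_eq_mul_compress (det_gram_twoCol hey) hinv
  set R := compress M (twoCol e y) with hR
  have hR' : R = !![R 0 0, R 0 1; R 1 0, R 1 1] := by
    ext i j; fin_cases i <;> fin_cases j <;> rfl
  rw [mul_twoCol, hR', ← twoCol_combination] at hMQ
  have hcol1 : apply M e = R 0 0 • e + R 1 0 • y := by
    ext i; simpa [twoCol] using congrFun (congrFun hMQ i) 0
  have hcol2 : apply M y = R 0 1 • e + R 1 1 • y := by
    ext i; simpa [twoCol] using congrFun (congrFun hMQ i) 1
  have hz := LinearIndependent.pair_iff.1 hey (R 0 0 - lam) (R 1 0) (by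
    rw [sub_smul, ← hMe, hcol1]; abel)
  have h00 : R 0 0 = lam := sub_eq_zero.1 hz.1
  refine ⟨R 1 1, by rw [Matrix.trace_fin_two, h00], by
    rw [Matrix.det_fin_two, h00, hz.2]; ring, ?_⟩
  -- Otherwise y would be a generalized eigenvector for lam independent of e, against simplicity.
  have hne : R 1 1 ≠ lam := by
    intro h1
    obtain ⟨b, hb⟩ := exists_smul_eq_of_simple hlam.1 he hMe (R 0 1) (v := y) (by
      rw [hcol2, h1, add_comm])
    have := LinearIndependent.pair_iff.1 hey b (-1) (by rw [hb]; simp)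
    simp at this
  have hsub : R 1 1 - lam ≠ 0 := sub_ne_zero.2 hne
  have hspec : R 1 1 ∈ spectrum ℂ M := by
    -- R is upper triangular with diagonal lam, R 1 1; this is its eigenvector for R 1 1 in the
    -- basis e, y.
    refine mem_spectrum_of_apply (v := R 0 1 • e + (R 1 1 - lam) • y) ?_ ?_
    · intro h0
      exact hsub (LinearIndependent.pair_iff.1 hey _ _ h0).2
    · have hadd : ∀ a b : EuclideanSpace ℂ (Fin n), apply M (a + b) = apply M a + apply M b := by
        intro a b; simp [apply, Matrix.mulVec_add]
      rw [hadd, apply_smul, apply_smul, hMe, hcol2]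
      module
  have hlt := hlam.2 _ hspec hne (by rwa [Complex.conj_eq_iff_im.2 him])
  have hnorm : ‖lam‖ = lam.re := by
    have : lam = (lam.re : ℂ) := by apply Complex.ext <;> simp [him]
    rw [this, Complex.norm_real, Real.norm_of_nonneg hre.le]; simp
  exact ((Complex.re_le_norm _).trans_lt hlt).trans_eq hnorm

theorem twoCol_swap_combination {a b : EuclideanSpace ℂ (Fin n)} (s c : ℂ) :
    twoCol b (s • (a - c • b)) = twoCol a b * !![0, s; 1, -(s * c)] := by
  rw [← twoCol_combination]
  congr 1
  · simp
  · module

/-- Parallel states span the same line. The index 0 is excluded because `projOne` starts at the zero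
matrix rather than at the line of the initial vector. -/
theorem distOne_eq_zero {x₀ : EuclideanSpace ℂ (Fin n)} (hx₀ : ‖x₀‖ = 1)
    (h : ∀ k, iter M x₀ k ≠ 0) {k : ℕ} (hk : 1 ≤ k) {c : ℂ}
    (hc : state M x₀ k - c • state M x₀ (k + 1) = 0) : distOne M x₀ k = 0 := by
  obtain ⟨j, rfl⟩ := Nat.exists_eq_add_of_le' hk
  have hc0 : c ≠ 0 := by
    rintro rfl
    have := norm_state hx₀ h (j + 1)
    rw [zero_smul, sub_zero] at hc
    simp [hc] at this
  rw [distOne, projOne, projOne, sub_eq_zero.1 hc, proj_oneCol_smul hc0, projDist_self]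

/-- The columns x_k, x_{k+1} become parallel, so their planes need not converge. Replacing x_k by
its normalized component orthogonal to x_{k+1} gives an orthonormal basis, which has a limit e, y'
along the ultrafilter by compactness. The distance hypothesis makes the limiting plane invariant. -/
theorem tendsto_lamTwo_of_distTwo_lt {lam : ℂ} (him : lam.im = 0) (hre : 0 < lam.re)
    (hlam : IsSimpleDominant M lam) {x₀ : EuclideanSpace ℂ (Fin n)} (hx₀ : ‖x₀‖ = 1)
    (hiter : ∀ k, iter M x₀ k ≠ 0)
    {e : EuclideanSpace ℂ (Fin n)} (he : ‖e‖ = 1) (hMe : apply M e = lam • e)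
    (hlim : Tendsto (state M x₀) atTop (𝓝 e)) (U : Ultrafilter ℕ) (hU : (U : Filter ℕ) ≤ atTop)
    (hlt : ∀ᶠ k in (U : Filter ℕ), distTwo M x₀ k < distOne M x₀ k) :
    Tendsto (lamTwo M x₀) U (𝓝 ‖lam‖) := by
  have he0 : e ≠ 0 := by rw [← norm_ne_zero_iff, he]; exact one_ne_zero
  set c : ℕ → ℂ := fun k => inner ℂ (state M x₀ (k + 1)) (state M x₀ k) with hc
  set g : ℕ → EuclideanSpace ℂ (Fin n) :=
    fun k => state M x₀ k - c k • state M x₀ (k + 1) with hg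
  set s : ℕ → ℂ := fun k => ((‖g k‖⁻¹ : ℝ) : ℂ) with hs
  set y : ℕ → EuclideanSpace ℂ (Fin n) := fun k => s k • g k with hy
  -- If the orthogonal component vanished, `distOne` would be 0 and `distTwo` could not be smaller.
  have hgood : ∀ᶠ k in (U : Filter ℕ), g k ≠ 0 := by
    filter_upwards [hlt, hU (eventually_ge_atTop 1)] with k hk hk1 h0
    rw [distOne_eq_zero hx₀ hiter hk1 h0] at hk
    exact absurd hk (not_lt.2 (projDist_nonneg _ _))
  have hynorm : ∀ᶠ k in (U : Filter ℕ), ‖y k‖ = 1 := by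
    filter_upwards [hgood] with k hk
    have := norm_ne_zero_iff.2 hk
    rw [hy, hs]; simp only
    rw [norm_smul, Complex.norm_real, norm_inv, norm_norm, inv_mul_cancel₀ this]
  have hyinner : ∀ k, inner ℂ (state M x₀ (k + 1)) (y k) = 0 := by
    intro k
    simp only [hy, hg, inner_smul_right, inner_sub_right, inner_self_eq_norm_sq_to_K,
      norm_state hx₀ hiter]
    simp [hc]
  obtain ⟨y', -, hy'⟩ := (isCompact_closedBall (0 : EuclideanSpace ℂ (Fin n)) 1).ultrafilter_le_nhds
    (U.map y) (le_principal_iff.2 (by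
      change ∀ᶠ k in (U : Filter ℕ), y k ∈ Metric.closedBall 0 1
      filter_upwards [hynorm] with k hk
      simp [hk]))
  have hylim : Tendsto y U (𝓝 y') := hy'
  have hblim : Tendsto (fun k => state M x₀ (k + 1)) U (𝓝 e) :=
    ((tendsto_add_atTop_iff_nat 1).2 hlim).mono_left hU
  have hy'norm : ‖y'‖ = 1 :=
    tendsto_nhds_unique hylim.norm (tendsto_const_nhds.congr' (hynorm.mono fun k hk => hk.symm))
  have hy'inner : inner ℂ e y' = 0 :=
    tendsto_nhds_unique (hblim.inner hylim) (by simp only [hyinner]; exact tendsto_const_nhds)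
  have hind := linearIndependent_of_inner_eq_zero he hy'norm hy'inner
  have hQ : ∀ k, twoCol (state M x₀ (k + 1)) (y k) =
      twoCol (state M x₀ k) (state M x₀ (k + 1)) * !![0, s k; 1, -(s k * c k)] :=
    fun k => twoCol_swap_combination (s k) (c k)
  have hT : ∀ᶠ k in (U : Filter ℕ), (!![0, s k; 1, -(s k * c k)]).det ≠ 0 := by
    filter_upwards [hgood] with k hk
    have := norm_ne_zero_iff.2 hk
    simpa [Matrix.det_fin_two, hs] using hk
  have hQlim : Tendsto (fun k => twoCol (state M x₀ (k + 1)) (y k)) U (𝓝 (twoCol e y')) :=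
    tendsto_twoCol hblim hylim
  have hgram := det_gram_twoCol hind
  have hP : Tendsto (fun k => projTwo M x₀ (k + 1)) U (𝓝 (proj (twoCol e y'))) := by
    refine (tendsto_proj hQlim hgram).congr' ?_
    filter_upwards [hT] with k hk
    rw [hQ, proj_mul_right _ hk, projTwo]
  have hdOne : Tendsto (distOne M x₀) U (𝓝 0) := by
    have h := tendsto_projOne he0 hlim
    exact (tendsto_projDist ((tendsto_add_atTop_iff_nat 1).2 h) h).mono_left hU
  have hdTwo : Tendsto (distTwo M x₀) U (𝓝 0) :=
    tendsto_of_tendsto_of_tendsto_of_le_of_le' tendsto_const_nhds hdOne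
      (Eventually.of_forall fun k => projDist_nonneg _ _) (hlt.mono fun k hk => hk.le)
  have hP' : Tendsto (fun k => projTwo M x₀ k) U (𝓝 (proj (twoCol e y'))) :=
    tendsto_of_tendsto_projDist hP hdTwo
  -- Consecutive planes have the same limit, so the one-step relation between them becomes
  -- invariance of that limit.
  have hinv : (1 - proj (twoCol e y')) * M * proj (twoCol e y') = 0 := by
    refine tendsto_nhds_unique (tendsto_matrix_mul (tendsto_matrix_mul (hP.const_sub 1)
      tendsto_const_nhds) hP') ?_
    refine tendsto_const_nhds.congr' ?_
    have hev : ∀ᶠ k in (U : Filter ℕ), ((twoCol (state M x₀ (k + 1)) (y k))ᴴ *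
        twoCol (state M x₀ (k + 1)) (y k)).det ≠ 0 := by
      filter_upwards [hynorm] with k hk
      exact det_gram_twoCol
        (linearIndependent_of_inner_eq_zero (norm_state hx₀ hiter _) hk (hyinner k))
    filter_upwards [hev] with k hk
    rw [hQ] at hk
    exact (one_sub_projTwo_mul_mul_projTwo hx₀ hiter k (det_gram_of_mul hk)).symm
  obtain ⟨μ, htr, hdet, hμ⟩ := exists_trace_det_compress him hre hlam hind hMe hinv
  refine (tendsto_eigAbs_of_re_lt (tendsto_compress hQlim hgram) htr hdet hμ).congr' ?_
  filter_upwards [hT] with k hk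
  rw [hQ, eigAbs_compress_mul_right _ _ hk, lamTwo]

end Convergence

section ConjugatePair

variable {n : ℕ} {M : Matrix (Fin n) (Fin n) ℂ}

/-! ### A pair of conjugate dominant eigenvalues -/

theorem linearIndependent_of_eigen {lam ν : ℂ} (hne : lam ≠ ν)
    {u u' : EuclideanSpace ℂ (Fin n)} (hu0 : u ≠ 0) (hu'0 : u' ≠ 0)
    (hu : apply M u = lam • u) (hu' : apply M u' = ν • u') : LinearIndependent ℂ ![u', u] := by
  rw [LinearIndependent.pair_iff]
  intro s t h
  have hadd : apply M (s • u' + t • u) = s • apply M u' + t • apply M u := by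
    simp [apply, Matrix.mulVec_add, Matrix.mulVec_smul]
  have h0 : apply M (0 : EuclideanSpace ℂ (Fin n)) = 0 := by simp [apply]
  rw [h, h0, hu, hu'] at hadd
  have h1 : (t * (lam - ν)) • u = 0 := by
    have : (t * (lam - ν)) • u = (s • ν • u' + t • lam • u) - ν • (s • u' + t • u) := by module
    rw [this, ← hadd, h]; simp
  have ht : t = 0 := by
    rcases smul_eq_zero.1 h1 with h2 | h2
    · exact (mul_eq_zero.1 h2).resolve_right (sub_ne_zero.2 hne)
    · exact absurd h2 hu0
  subst ht
  rw [zero_smul, add_zero] at h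
  exact ⟨(smul_eq_zero.1 h).resolve_right hu'0, rfl⟩

/-- Applying M - conj lam to M ^ k x₀ and dividing by lam ^ k isolates the lam-direction; exchanging
the two eigenvalues isolates the other. Both vectors are combinations of two consecutive states. -/
theorem exists_tendsto_pair {lam : ℂ} (him : lam.im ≠ 0) (hlam : IsSimpleDominant M lam)
    (hconj : M.charpoly.rootMultiplicity (conj lam) = 1) {x₀ : EuclideanSpace ℂ (Fin n)}
    (hx₀ : ‖x₀‖ = 1) (hx : HasSpectralComponent M lam x₀)
    (hx' : HasSpectralComponent M (conj lam) x₀) :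
    ∃ u u', u ≠ 0 ∧ u' ≠ 0 ∧ apply M u = lam • u ∧ apply M u' = conj lam • u' ∧
      ∃ T : ℕ → Matrix (Fin 2) (Fin 2) ℂ, (∀ k, (T k).det ≠ 0) ∧
        Tendsto (fun k => twoCol (state M x₀ k) (state M x₀ (k + 1)) * T k) atTop
          (𝓝 (twoCol u' u)) := by
  have hlam0 : lam ≠ 0 := fun h => by simp [h] at him
  have hclam0 : conj lam ≠ 0 := fun h => hlam0 (by simpa using h)
  have hne : lam ≠ conj lam := fun h => him (Complex.conj_eq_iff_im.1 h.symm)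
  have hiter := iter_ne_zero hlam0 hx
  have hr : (Matrix.toLin' M).charpoly.rootMultiplicity lam = 1 := by
    rw [Matrix.charpoly_toLin']; exact hlam.1
  have hr' : (Matrix.toLin' M).charpoly.rootMultiplicity (conj lam) = 1 := by
    rw [Matrix.charpoly_toLin']; exact hconj
  obtain ⟨u, hu0, hu, hl⟩ := tendsto_pow_apply_pair (f := Matrix.toLin' M) hr hr' hlam0 hne
    (fun κ hκ h1 h2 => hlam.2 κ (hasEigenvalue_toLin'_iff.1 hκ) h1 h2) hx
  obtain ⟨u', hu'0, hu', hl'⟩ := tendsto_pow_apply_pair (f := Matrix.toLin' M) hr' hr hclam0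
    hne.symm (fun κ hκ h1 h2 => by
      rw [Complex.norm_conj]; exact hlam.2 κ (hasEigenvalue_toLin'_iff.1 hκ) h2 h1) hx'
  have hlim : Tendsto (fun k => (lam ^ k)⁻¹ • (iter M x₀ (k + 1) - conj lam • iter M x₀ k))
      atTop (𝓝 (WithLp.toLp 2 u)) :=
    ((PiLp.continuous_toLp 2 (fun _ : Fin n => ℂ)).tendsto u).comp hl
  have hlim' : Tendsto (fun k => (conj lam ^ k)⁻¹ • (iter M x₀ (k + 1) - lam • iter M x₀ k))
      atTop (𝓝 (WithLp.toLp 2 u')) :=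
    ((PiLp.continuous_toLp 2 (fun _ : Fin n => ℂ)).tendsto u').comp hl'
  -- The norms in T undo the normalization of the states. Its determinant is a nonzero multiple of
  -- conj lam - lam.
  refine ⟨WithLp.toLp 2 u, WithLp.toLp 2 u', fun h0 => hu0 ((WithLp.toLp_eq_zero 2).1 h0),
    fun h0 => hu'0 ((WithLp.toLp_eq_zero 2).1 h0), (apply_eq_smul_iff M).2 hu,
    (apply_eq_smul_iff M).2 hu', fun k =>
      !![-(‖iter M x₀ k‖ : ℂ) * lam * (conj lam ^ k)⁻¹,
          -(‖iter M x₀ k‖ : ℂ) * conj lam * (lam ^ k)⁻¹;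
        (‖iter M x₀ (k + 1)‖ : ℂ) * (conj lam ^ k)⁻¹, (‖iter M x₀ (k + 1)‖ : ℂ) * (lam ^ k)⁻¹],
    fun k => ?_, ?_⟩
  · have h1 : (‖iter M x₀ k‖ : ℂ) ≠ 0 := by exact_mod_cast norm_ne_zero_iff.2 (hiter k)
    have h2 : (‖iter M x₀ (k + 1)‖ : ℂ) ≠ 0 := by
      exact_mod_cast norm_ne_zero_iff.2 (hiter (k + 1))
    have h3 := pow_ne_zero k hlam0
    have h4 := pow_ne_zero k hclam0
    rw [Matrix.det_fin_two_of]
    have : -(‖iter M x₀ k‖ : ℂ) * lam * (conj lam ^ k)⁻¹ * ((‖iter M x₀ (k + 1)‖ : ℂ) * (lam ^ k)⁻¹)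
        - -(‖iter M x₀ k‖ : ℂ) * conj lam * (lam ^ k)⁻¹ *
          ((‖iter M x₀ (k + 1)‖ : ℂ) * (conj lam ^ k)⁻¹) =
        (‖iter M x₀ k‖ : ℂ) * ‖iter M x₀ (k + 1)‖ * (lam ^ k)⁻¹ * (conj lam ^ k)⁻¹ *
          (conj lam - lam) := by ring
    rw [this]
    exact mul_ne_zero (mul_ne_zero (mul_ne_zero (mul_ne_zero h1 h2) (inv_ne_zero h3))
      (inv_ne_zero h4)) (sub_ne_zero.2 hne.symm)
  · refine (tendsto_twoCol hlim' hlim).congr fun k => ?_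
    have key : ∀ j, (‖iter M x₀ j‖ : ℂ) • state M x₀ j = iter M x₀ j := fun j => by
      have h1 := norm_ne_zero_iff.2 (hiter j)
      rw [state_eq hx₀ hiter, Complex.coe_smul, smul_smul, mul_inv_cancel₀ h1, one_smul]
    rw [← twoCol_combination]
    conv_lhs => rw [← key k, ← key (k + 1)]
    congr 1 <;> module

theorem mul_twoCol_pair {lam : ℂ} {u u' : EuclideanSpace ℂ (Fin n)}
    (hu : apply M u = lam • u) (hu' : apply M u' = conj lam • u') :
    M * twoCol u' u = twoCol u' u * !![conj lam, 0; 0, lam] := by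
  rw [mul_twoCol, hu, hu', ← twoCol_combination]; simp

section

variable {x₀ u u' : EuclideanSpace ℂ (Fin n)} {T : ℕ → Matrix (Fin 2) (Fin 2) ℂ}

theorem tendsto_projTwo (hind : LinearIndependent ℂ ![u', u]) (hT : ∀ k, (T k).det ≠ 0)
    (hlim : Tendsto (fun k => twoCol (state M x₀ k) (state M x₀ (k + 1)) * T k) atTop
      (𝓝 (twoCol u' u))) :
    Tendsto (projTwo M x₀) atTop (𝓝 (proj (twoCol u' u))) := by
  rw [← tendsto_add_atTop_iff_nat 1]
  refine (tendsto_proj hlim (det_gram_twoCol hind)).congr fun k => ?_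
  rw [proj_mul_right _ (hT k), projTwo]

theorem tendsto_lamTwo {lam : ℂ} (hind : LinearIndependent ℂ ![u', u])
    (hu : apply M u = lam • u) (hu' : apply M u' = conj lam • u') (hT : ∀ k, (T k).det ≠ 0)
    (hlim : Tendsto (fun k => twoCol (state M x₀ k) (state M x₀ (k + 1)) * T k) atTop
      (𝓝 (twoCol u' u))) :
    Tendsto (lamTwo M x₀) atTop (𝓝 ‖lam‖) := by
  have hgram := det_gram_twoCol hind
  have hc := compress_eq_of_mul_eq hgram (mul_twoCol_pair hu hu')
  refine (tendsto_eigAbs_of_conj (tendsto_compress (A := M) hlim hgram) (a := lam) ?_ ?_).congr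
    fun k => ?_
  · rw [hc, Matrix.trace_fin_two_of]
  · rw [hc, Matrix.det_fin_two_of]; ring
  · rw [eigAbs_compress_mul_right _ _ (hT k), lamTwo]

/-- The states may keep rotating in the dominant plane. Along the ultrafilter they have a limit x,
and the vanishing distance makes its line invariant. As x lies in the span of u' and u, its
eigenvalue is one of the dominant pair. -/
theorem tendsto_lamOne_of_distOne_le {lam : ℂ} (hx₀ : ‖x₀‖ = 1) (hiter : ∀ k, iter M x₀ k ≠ 0)
    (hind : LinearIndependent ℂ ![u', u])
    (hu : apply M u = lam • u) (hu' : apply M u' = conj lam • u') (hT : ∀ k, (T k).det ≠ 0)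
    (hlim : Tendsto (fun k => twoCol (state M x₀ k) (state M x₀ (k + 1)) * T k) atTop
      (𝓝 (twoCol u' u))) (U : Ultrafilter ℕ) (hU : (U : Filter ℕ) ≤ atTop)
    (hle : ∀ᶠ k in (U : Filter ℕ), distOne M x₀ k ≤ distTwo M x₀ k) :
    Tendsto (lamOne M x₀) U (𝓝 ‖lam‖) := by
  have hgram := det_gram_twoCol hind
  have hns := norm_state hx₀ hiter
  obtain ⟨x, -, hx⟩ :=
    (isCompact_closedBall (0 : EuclideanSpace ℂ (Fin n)) 1).ultrafilter_le_nhds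
    (U.map fun k => state M x₀ (k + 1)) (le_principal_iff.2 (by
      change ∀ᶠ k in (U : Filter ℕ), state M x₀ (k + 1) ∈ Metric.closedBall 0 1
      exact Eventually.of_forall fun k => by simp [hns]))
  have hxlim : Tendsto (fun k => state M x₀ (k + 1)) U (𝓝 x) := hx
  have hxnorm : ‖x‖ = 1 :=
    tendsto_nhds_unique hxlim.norm (by simp only [hns]; exact tendsto_const_nhds)
  have hx0 : x ≠ 0 := by rw [← norm_ne_zero_iff, hxnorm]; exact one_ne_zero
  have hgx := det_gram_oneCol hx0
  have hP2 := tendsto_projTwo hind hT hlim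
  have hP2' := (tendsto_add_atTop_iff_nat 1).2 hP2
  have hdTwo : Tendsto (distTwo M x₀) U (𝓝 0) := (tendsto_projDist hP2' hP2).mono_left hU
  have hdOne : Tendsto (distOne M x₀) U (𝓝 0) :=
    tendsto_of_tendsto_of_tendsto_of_le_of_le' tendsto_const_nhds hdTwo
      (Eventually.of_forall fun k => projDist_nonneg _ _) hle
  have hP : Tendsto (fun k => projOne M x₀ (k + 1)) U (𝓝 (proj (oneCol x))) :=
    tendsto_proj (tendsto_oneCol hxlim) hgx
  have hP' : Tendsto (fun k => projOne M x₀ k) U (𝓝 (proj (oneCol x))) :=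
    tendsto_of_tendsto_projDist hP hdOne
  have hinv : (1 - proj (oneCol x)) * M * proj (oneCol x) = 0 := by
    refine tendsto_nhds_unique (tendsto_matrix_mul (tendsto_matrix_mul (hP.const_sub 1)
      tendsto_const_nhds) hP') ?_
    simp only [one_sub_projOne_mul_mul_projOne hx₀ hiter]
    exact tendsto_const_nhds
  have hMx := mul_eq_mul_compress hgx hinv
  set ρ := compress M (oneCol x) 0 0 with hρ
  have hρ' : compress M (oneCol x) = !![ρ] := by
    ext i j; fin_cases i; fin_cases j; rfl
  rw [hρ', mul_oneCol, ← oneCol_smul] at hMx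
  have hMx' : apply M x = ρ • x := by
    ext i; simpa [oneCol] using congrFun (congrFun hMx i) 0
  -- Each x_{k+1} is fixed by the projection onto its own plane; the limit is thus fixed by the
  -- limiting projection.
  have hfix : proj (twoCol u' u) * oneCol x = oneCol x := by
    refine tendsto_nhds_unique (tendsto_matrix_mul (hP2'.mono_left hU) (tendsto_oneCol hxlim)) ?_
    refine (tendsto_oneCol hxlim).congr' ?_
    have hdet : Tendsto (fun k => ((twoCol (state M x₀ k) (state M x₀ (k + 1)) * T k)ᴴ *
        (twoCol (state M x₀ k) (state M x₀ (k + 1)) * T k)).det) U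
        (𝓝 ((twoCol u' u)ᴴ * twoCol u' u).det) := by
      have hcont : Continuous fun X : Matrix (Fin 2) (Fin 2) ℂ => X.det :=
        continuous_id.matrix_det
      have h := hlim.mono_left hU
      exact (hcont.tendsto _).comp (tendsto_matrix_mul (tendsto_conjTranspose h) h)
    filter_upwards [hdet.eventually_ne hgram] with k hk
    have h1 := proj_mul_self (det_gram_of_mul hk)
    have h2 : oneCol (state M x₀ (k + 1)) =
        twoCol (state M x₀ k) (state M x₀ (k + 1)) * !![(0 : ℂ); 1] := by
      ext i j; simp [oneCol, twoCol, Matrix.mul_apply]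
    change _ = proj (twoCol (state M x₀ k) (state M x₀ (k + 1))) * oneCol (state M x₀ (k + 1))
    rw [h2, ← Matrix.mul_assoc, h1]
  obtain ⟨p, q, hpq⟩ : ∃ p q : ℂ, x = p • u' + q • u := by
    set C := ((twoCol u' u)ᴴ * twoCol u' u)⁻¹ * (twoCol u' u)ᴴ * oneCol x with hC
    have h3 : oneCol x = twoCol u' u * C := by
      rw [← hfix, proj, hC]; simp only [Matrix.mul_assoc]
    refine ⟨C 0 0, C 1 0, ?_⟩
    ext i
    have := congrFun (congrFun h3 i) 0
    simpa [oneCol, twoCol, Matrix.mul_apply, mul_comm] using this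
  have hρlam : ‖ρ‖ = ‖lam‖ := by
    have h4 : apply M x = p • conj lam • u' + q • lam • u := by
      have hadd : apply M (p • u' + q • u) = p • apply M u' + q • apply M u := by
        simp [apply, Matrix.mulVec_add, Matrix.mulVec_smul]
      rw [hpq, hadd, hu, hu']
    rw [hMx', hpq] at h4
    obtain ⟨h5, h6⟩ := LinearIndependent.pair_iff.1 hind (p * (ρ - conj lam)) (q * (ρ - lam)) (by
      have : (p * (ρ - conj lam)) • u' + (q * (ρ - lam)) • u =
        ρ • (p • u' + q • u) - (p • conj lam • u' + q • lam • u) := by module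
      rw [this, h4, sub_self])
    rcases mul_eq_zero.1 h5 with h7 | h7
    · rcases mul_eq_zero.1 h6 with h8 | h8
      · exact absurd (by rw [hpq, h7, h8]; simp) hx0
      · rw [sub_eq_zero.1 h8]
    · rw [sub_eq_zero.1 h7, Complex.norm_conj]
  rw [← hρlam]
  exact (tendsto_entry (tendsto_compress (A := M) (tendsto_oneCol hxlim) hgx) 0 0).norm

end

end ConjugatePair

namespace WeightedDigraph

variable {n : ℕ} (G : WeightedDigraph n)

/-! ### The kernels of the Laplacian -/

open Classical in
/-- The adjacency matrix, with zero diagonal. -/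
noncomputable def adj (i j : Fin n) : ℝ := if G.Edge j i then G.w i j else 0

theorem adj_nonneg (i j : Fin n) : 0 ≤ G.adj i j := by
  unfold adj
  split_ifs with h
  · exact G.nonneg i j h.1.symm
  · exact le_rfl

variable {G} in
theorem Edge.adj_ne_zero {i j : Fin n} (h : G.Edge j i) : G.adj i j ≠ 0 := by
  unfold adj; rw [if_pos h]; exact h.2

theorem adj_self (i : Fin n) : G.adj i i = 0 := by simp [adj, Edge]

theorem adj_of_ne {i j : Fin n} (h : j ≠ i) : G.adj i j = G.w i j := by
  unfold adj Edge
  by_cases h0 : G.w i j = 0 <;> simp [h, h0]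

theorem laplacian_apply (i j : Fin n) :
    G.laplacian i j = (if j = i then ∑ k, G.adj i k else 0) - G.adj i j := by
  classical
  have hsum : ∑ k ∈ Finset.univ.filter (fun k => k ≠ i), G.w i k = ∑ k, G.adj i k := by
    rw [Finset.sum_filter]
    refine Finset.sum_congr rfl fun k _ => ?_
    by_cases hk : k = i
    · simp [hk, adj_self]
    · simp [hk, adj_of_ne G hk]
  by_cases hji : j = i
  · subst hji
    simp only [laplacian, Matrix.of_apply, Edge, ne_eq, not_true_eq_false, false_and, if_false,
      if_true, adj_self, sub_zero]
    convert hsum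
  · by_cases he : G.Edge j i
    · simp [laplacian, he, hji, adj]
    · simp [laplacian, he, hji, adj]

theorem laplacian_mulVec (u : Fin n → ℝ) (i : Fin n) :
    (G.laplacian *ᵥ u) i = ∑ j, G.adj i j * (u i - u j) := by
  simp only [Matrix.mulVec, dotProduct, laplacian_apply, sub_mul, ite_mul, zero_mul,
    Finset.sum_sub_distrib, Finset.sum_ite_eq', Finset.mem_univ, if_true, mul_sub,
    Finset.sum_mul]

theorem vecMul_laplacian (u : Fin n → ℝ) (j : Fin n) :
    (u ᵥ* G.laplacian) j = u j * ∑ k, G.adj j k - ∑ i, u i * G.adj i j := by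
  simp [Matrix.vecMul, dotProduct, laplacian_apply, mul_sub, Finset.sum_sub_distrib, mul_ite]

variable {G}

/-- Maximum principle: at a vertex where u is maximal, a sum of nonnegative terms vanishes, so all
in-neighbors attain the maximum too. Strong connectivity spreads this everywhere. -/
theorem eq_of_laplacian_mulVec_eq_zero (hG : G.StronglyConnected) {u : Fin n → ℝ}
    (hu : G.laplacian *ᵥ u = 0) (i j : Fin n) : u i = u j := by
  obtain ⟨m, -, hm⟩ := Finset.exists_max_image Finset.univ u ⟨i, Finset.mem_univ i⟩
  have step : ∀ a b, G.Edge a b → u b = u m → u a = u m := by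
    intro a b hab hb
    have h0 : ∑ j, G.adj b j * (u b - u j) = 0 := by rw [← laplacian_mulVec, hu]; rfl
    have h1 := (Finset.sum_eq_zero_iff_of_nonneg (fun j _ => mul_nonneg (G.adj_nonneg b j)
      (by rw [hb]; exact sub_nonneg.2 (hm j (Finset.mem_univ j))))).1 h0 a (Finset.mem_univ a)
    have h2 := (mul_eq_zero.1 h1).resolve_left hab.adj_ne_zero
    rw [← hb]; linarith
  have all : ∀ a, u a = u m := by
    intro a
    by_cases ham : a = m
    · rw [ham]
    · have h := hG a m ham
      induction h using Relation.TransGen.head_induction_on with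
      | single h => exact step _ _ h rfl
      | head h _ ih =>
        rename_i p q _
        by_cases hq : q = m
        · exact step _ _ h (by rw [hq])
        · exact step _ _ h (ih hq)
  rw [all i, all j]

/-- At a zero of u the column equation is a vanishing sum of nonnegative terms, so zeros propagate
along edges. -/
theorem eq_zero_of_vecMul_laplacian_eq_zero (hG : G.StronglyConnected) {u : Fin n → ℝ}
    (hu0 : ∀ i, 0 ≤ u i) (hu : u ᵥ* G.laplacian = 0) {m : Fin n} (hm : u m = 0) (i : Fin n) :
    u i = 0 := by
  have step : ∀ a b, G.Edge a b → u a = 0 → u b = 0 := by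
    intro a b hab ha
    have h0 : ∑ i, u i * G.adj i a = 0 := by
      have := congrFun hu a
      rw [vecMul_laplacian, ha] at this
      simpa using this
    have h1 := (Finset.sum_eq_zero_iff_of_nonneg (fun j _ => mul_nonneg (hu0 j)
      (G.adj_nonneg j a))).1 h0 b (Finset.mem_univ b)
    exact (mul_eq_zero.1 h1).resolve_right hab.adj_ne_zero
  by_cases him : i = m
  · rw [him, hm]
  · have h := hG m i (Ne.symm him)
    clear him
    induction h with
    | single h => exact step _ _ h hm
    | tail _ h ih => exact step _ _ h ih

/-- The triangle inequality gives an inequality in each column. Summed over all columns the two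
sides agree, so every one is an equality. -/
theorem vecMul_abs_laplacian {u : Fin n → ℝ} (hu : u ᵥ* G.laplacian = 0) :
    (fun i => |u i|) ᵥ* G.laplacian = 0 := by
  have hle : ∀ j ∈ Finset.univ, |u j| * ∑ k, G.adj j k ≤ ∑ i, |u i| * G.adj i j := by
    intro j _
    have h1 := congrFun hu j
    rw [vecMul_laplacian, Pi.zero_apply, sub_eq_zero] at h1
    have h2 : 0 ≤ ∑ k, G.adj j k := Finset.sum_nonneg fun k _ => G.adj_nonneg j k
    rw [← abs_of_nonneg h2, ← abs_mul, h1]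
    refine (Finset.abs_sum_le_sum_abs _ _).trans_eq (Finset.sum_congr rfl fun i _ => ?_)
    rw [abs_mul, abs_of_nonneg (G.adj_nonneg i j)]
  have hsum : ∑ j, |u j| * ∑ k, G.adj j k = ∑ j, ∑ i, |u i| * G.adj i j := by
    rw [Finset.sum_comm]
    simp only [Finset.mul_sum]
  have := (Finset.sum_eq_sum_iff_of_le hle).1 hsum
  ext j
  rw [vecMul_laplacian, this j (Finset.mem_univ j), sub_self, Pi.zero_apply]

/-- Both |u| - u and |u| + u are nonnegative left null vectors. One of them vanishes at m, hence
everywhere, so u has constant sign and a zero sum forces u = 0. -/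
theorem sum_ne_zero_of_vecMul_laplacian (hG : G.StronglyConnected) {u : Fin n → ℝ}
    (hu : u ᵥ* G.laplacian = 0) (hu0 : u ≠ 0) : ∑ i, u i ≠ 0 := by
  intro hs
  apply hu0
  have ha := vecMul_abs_laplacian hu
  have hv : ∀ i, u i ≤ |u i| ∧ -u i ≤ |u i| := fun i => ⟨le_abs_self _, neg_le_abs _⟩
  ext m
  rcases le_total 0 (u m) with hm | hm
  · have h := eq_zero_of_vecMul_laplacian_eq_zero hG (u := (fun i => |u i|) - u)
      (fun i => sub_nonneg.2 (hv i).1) (by rw [Matrix.sub_vecMul, ha, hu, sub_zero]) (m := m)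
      (by simp [abs_of_nonneg hm])
    have h' : ∀ i ∈ Finset.univ, 0 ≤ u i := fun i _ => by
      have := h i; simp only [Pi.sub_apply, sub_eq_zero] at this
      rw [← this]; exact abs_nonneg _
    exact (Finset.sum_eq_zero_iff_of_nonneg h').1 hs m (Finset.mem_univ m)
  · have h := eq_zero_of_vecMul_laplacian_eq_zero hG (u := (fun i => |u i|) + u)
      (fun i => by have := (hv i).2; simp only [Pi.add_apply]; linarith)
      (by rw [Matrix.add_vecMul, ha, hu, add_zero]) (m := m)
      (by simp [abs_of_nonpos hm])
    have h' : ∀ i ∈ Finset.univ, u i ≤ 0 := fun i _ => by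
      have := h i; simp only [Pi.add_apply] at this
      linarith [abs_nonneg (u i)]
    exact (Finset.sum_eq_zero_iff_of_nonpos h').1 hs m (Finset.mem_univ m)

/-! ### Spectra of the Laplacian and of the modified Laplacian -/

variable (G) in
/-- The Laplacian as a complex matrix. -/
noncomputable abbrev laplacianC : Matrix (Fin n) (Fin n) ℂ := G.laplacian.map (algebraMap ℝ ℂ)

theorem laplacianC_ker (hG : G.StronglyConnected) {u : Fin n → ℂ}
    (hu : G.laplacianC *ᵥ u = 0) (i j : Fin n) : u i = u j := by
  have hre : G.laplacian *ᵥ (fun i => (u i).re) = 0 := by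
    ext i
    have := congrArg Complex.re (congrFun hu i)
    simpa [Matrix.mulVec, dotProduct] using this
  have him : G.laplacian *ᵥ (fun i => (u i).im) = 0 := by
    ext i
    have := congrArg Complex.im (congrFun hu i)
    simpa [Matrix.mulVec, dotProduct] using this
  exact Complex.ext (eq_of_laplacian_mulVec_eq_zero hG hre i j)
    (eq_of_laplacian_mulVec_eq_zero hG him i j)

/-- Gershgorin discs have real centers and radii at most the maximal in-weight, which bounds the
imaginary parts. -/
theorem abs_im_mul_le (G : WeightedDigraph n) {δ : ℝ} (hδ_pos : 0 < δ) (hδ : δ < G.maxInWeight⁻¹)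
    {μ : ℂ} (hμ : μ ∈ spectrum ℂ G.laplacianC) : |δ * μ.im| ≤ 1 := by
  classical
  obtain ⟨k, hk⟩ := eigenvalue_mem_ball (hasEigenvalue_toLin'_iff.2 hμ)
  have hΔ : 0 < G.maxInWeight := inv_pos.1 (hδ_pos.trans hδ)
  have h1 : ∑ j, G.adj k j ≤ G.maxInWeight := by
    have h2 : ∑ j, G.adj k j = ∑ j ∈ Finset.univ.filter (fun j => G.Edge j k), G.w k j := by
      rw [Finset.sum_filter]; rfl
    rw [h2]
    unfold maxInWeight
    refine le_trans (le_of_eq ?_) (le_ciSup (Set.finite_range _).bddAbove k)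
    congr!
  have h3 : ∑ j ∈ Finset.univ.erase k, ‖G.laplacianC k j‖ ≤ ∑ j, G.adj k j := by
    refine (Finset.sum_le_sum fun j hj => ?_).trans
      (Finset.sum_le_univ_sum_of_nonneg fun j => G.adj_nonneg k j)
    have : G.laplacian k j = -G.adj k j := by
      rw [laplacian_apply, if_neg (Finset.ne_of_mem_erase hj), zero_sub]
    simp [laplacianC, this, abs_of_nonneg (G.adj_nonneg k j)]
  rw [mem_closedBall_iff_norm] at hk
  have h4 : |μ.im| ≤ G.maxInWeight := by
    have h5 := (Complex.abs_im_le_norm (μ - G.laplacianC k k)).trans (hk.trans (h3.trans h1))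
    simpa [laplacianC] using h5
  rw [abs_mul, abs_of_pos hδ_pos]
  calc δ * |μ.im| ≤ δ * G.maxInWeight := by gcongr
    _ ≤ G.maxInWeight⁻¹ * G.maxInWeight := by gcongr
    _ = 1 := inv_mul_cancel₀ hΔ.ne'

end WeightedDigraph

open scoped Matrix.Norms.Operator in
theorem exp_mulVec_of_eigen {n : ℕ} {B : Matrix (Fin n) (Fin n) ℂ} {u : Fin n → ℂ} {μ : ℂ}
    (h : B *ᵥ u = μ • u) : NormedSpace.exp B *ᵥ u = Complex.exp μ • u := by
  have h1 := NormedSpace.exp_series_hasSum_exp' (𝕂 := ℂ) B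
  have hcont : Continuous fun X : Matrix (Fin n) (Fin n) ℂ => X *ᵥ u :=
    continuous_id.matrix_mulVec continuous_const
  have h2 := h1.map (AddMonoidHom.mk' (fun X : Matrix (Fin n) (Fin n) ℂ => X *ᵥ u)
    fun X Y => Matrix.add_mulVec X Y u) hcont
  have h3 := (NormedSpace.exp_series_hasSum_exp' (𝕂 := ℂ) μ).smul_const u
  rw [← Complex.exp_eq_exp_ℂ] at h3
  refine h2.unique (h3.congr_fun ?_)
  intro k
  have hpow : ∀ k, (B ^ k) *ᵥ u = μ ^ k • u := by
    intro k
    induction k with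
    | zero => simp
    | succ k ih => rw [pow_succ, ← Matrix.mulVec_mulVec, h, Matrix.mulVec_smul, ih, smul_smul,
        pow_succ, mul_comm]
  simp [Matrix.smul_mulVec, hpow, smul_smul]

namespace WeightedDigraph

variable {n : ℕ} {G : WeightedDigraph n}

/-- A real vector as a complex one. -/
def toComplex (w : EuclideanSpace ℝ (Fin n)) : Fin n → ℂ := fun i => (w i : ℂ)

open scoped Matrix.Norms.Operator in
theorem modifiedLaplacian_eq (δ : ℝ) (w₁ : EuclideanSpace ℝ (Fin n)) :
    G.modifiedLaplacian δ w₁ = NormedSpace.exp (1 - (δ : ℂ) • G.laplacianC)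
      - Complex.exp 1 • Matrix.vecMulVec (toComplex w₁) (toComplex w₁) := by
  have hexp : (NormedSpace.exp (1 - δ • G.laplacian)).map (algebraMap ℝ ℂ) =
      NormedSpace.exp (1 - (δ : ℂ) • G.laplacianC) := by
    have hcont : Continuous ((algebraMap ℝ ℂ).mapMatrix : Matrix (Fin n) (Fin n) ℝ →+* _) := by
      exact continuous_id.matrix_map Complex.continuous_ofReal
    have h := NormedSpace.map_exp ((algebraMap ℝ ℂ).mapMatrix :
      Matrix (Fin n) (Fin n) ℝ →+* Matrix (Fin n) (Fin n) ℂ) hcont (1 - δ • G.laplacian)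
    refine h.trans ?_
    congr 1
    rw [map_sub, map_one]
    congr 1
    ext i j; simp
  rw [modifiedLaplacian, ← hexp]
  ext i j
  simp [toComplex, Matrix.vecMulVec_apply]

theorem toComplex_dotProduct_laplacianC {w₁ : EuclideanSpace ℝ (Fin n)}
    (hw₁ : w₁.ofLp ᵥ* G.laplacian = 0) : toComplex w₁ ᵥ* G.laplacianC = 0 := by
  ext j
  have := congrArg (fun x : ℝ => (x : ℂ)) (congrFun hw₁ j)
  simpa [Matrix.vecMul, dotProduct, toComplex] using this

theorem toComplex_dotProduct_self {w₁ : EuclideanSpace ℝ (Fin n)} (h : ‖w₁‖ = 1) :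
    toComplex w₁ ⬝ᵥ toComplex w₁ = 1 := by
  have h1 : ∑ i, w₁ i * w₁ i = 1 := by
    have := EuclideanSpace.norm_sq_eq w₁
    rw [h] at this
    simpa [sq] using this.symm
  have := congrArg (fun x : ℝ => (x : ℂ)) h1
  simpa [dotProduct, toComplex] using this

theorem modifiedLaplacian_mulVec (δ : ℝ) {w₁ : EuclideanSpace ℝ (Fin n)} {u : Fin n → ℂ}
    (hu : toComplex w₁ ⬝ᵥ u = 0) : G.modifiedLaplacian δ w₁ *ᵥ u =
      NormedSpace.exp (1 - (δ : ℂ) • G.laplacianC) *ᵥ u := by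
  rw [modifiedLaplacian_eq, Matrix.sub_mulVec, Matrix.smul_mulVec, Matrix.vecMulVec_mulVec, hu]
  simp

theorem exp_mulVec_of_laplacianC (δ : ℝ) {u : Fin n → ℂ} {μ : ℂ}
    (hu : G.laplacianC *ᵥ u = μ • u) :
    NormedSpace.exp (1 - (δ : ℂ) • G.laplacianC) *ᵥ u = Complex.exp (1 - δ * μ) • u := by
  refine exp_mulVec_of_eigen ?_
  rw [Matrix.sub_mulVec, Matrix.one_mulVec, Matrix.smul_mulVec, hu]
  module

/-- w₁ is a left eigenvector of the exponential for e, and the rank-one term cancels exactly that.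
-/
theorem vecMul_modifiedLaplacian (δ : ℝ) {w₁ : EuclideanSpace ℝ (Fin n)}
    (hw₁ : w₁.ofLp ᵥ* G.laplacian = 0) (hw₁_norm : ‖w₁‖ = 1) :
    toComplex w₁ ᵥ* G.modifiedLaplacian δ w₁ = 0 := by
  have h1 : toComplex w₁ ᵥ* NormedSpace.exp (1 - (δ : ℂ) • G.laplacianC) =
      Complex.exp 1 • toComplex w₁ := by
    rw [← Matrix.mulVec_transpose, ← Matrix.exp_transpose]
    refine exp_mulVec_of_eigen ?_
    rw [Matrix.mulVec_transpose, Matrix.vecMul_sub, Matrix.vecMul_one, Matrix.vecMul_smul,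
      toComplex_dotProduct_laplacianC hw₁]
    simp
  rw [modifiedLaplacian_eq, Matrix.vecMul_sub, h1, Matrix.vecMul_smul, Matrix.vecMul_vecMulVec,
    toComplex_dotProduct_self hw₁_norm]
  simp

/-- An eigenvector of L for μ ≠ 0 is orthogonal to the left null vector w₁, so the rank-one term
does not act on it. -/
theorem exp_mem_spectrum_modifiedLaplacian (δ : ℝ) {w₁ : EuclideanSpace ℝ (Fin n)}
    (hw₁ : w₁.ofLp ᵥ* G.laplacian = 0) {μ : ℂ} (hμ : μ ∈ spectrum ℂ G.laplacianC) (hμ0 : μ ≠ 0) :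
    Complex.exp (1 - δ * μ) ∈ spectrum ℂ (G.modifiedLaplacian δ w₁) := by
  obtain ⟨u, hu, hu0⟩ := (hasEigenvalue_toLin'_iff.2 hμ).exists_hasEigenvector
  rw [Module.End.mem_eigenspace_iff, Matrix.toLin'_apply] at hu
  have hwu : toComplex w₁ ⬝ᵥ u = 0 := by
    have h1 : μ * (toComplex w₁ ⬝ᵥ u) = 0 := by
      rw [← smul_eq_mul, ← dotProduct_smul, ← hu, Matrix.dotProduct_mulVec,
        toComplex_dotProduct_laplacianC hw₁, zero_dotProduct]
    exact (mul_eq_zero.1 h1).resolve_left hμ0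
  rw [← hasEigenvalue_toLin'_iff]
  refine Module.End.hasEigenvalue_of_hasEigenvector (x := u) ⟨?_, hu0⟩
  rw [Module.End.mem_eigenspace_iff, Matrix.toLin'_apply, modifiedLaplacian_mulVec δ hwu,
    exp_mulVec_of_laplacianC δ hu]

/-- The ν-eigenspace of M is orthogonal to w₁, so M acts there as the exponential, which commutes
with L. Hence L preserves it and has an eigenvector in it. The eigenvalue 0 is excluded: its
eigenvectors are constant, and w₁ has nonzero sum. -/
theorem exists_eq_exp_of_mem_spectrum (hG : G.StronglyConnected) (δ : ℝ)
    {w₁ : EuclideanSpace ℝ (Fin n)} (hw₁ : w₁.ofLp ᵥ* G.laplacian = 0) (hw₁_norm : ‖w₁‖ = 1)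
    {ν : ℂ} (hν : ν ∈ spectrum ℂ (G.modifiedLaplacian δ w₁)) (hν0 : ν ≠ 0) :
    ∃ μ ∈ spectrum ℂ G.laplacianC, μ ≠ 0 ∧ ν = Complex.exp (1 - δ * μ) := by
  set M := G.modifiedLaplacian δ w₁ with hM
  have horth : ∀ v, M *ᵥ v = ν • v → toComplex w₁ ⬝ᵥ v = 0 := by
    intro v hv
    have h1 : ν * (toComplex w₁ ⬝ᵥ v) = 0 := by
      rw [← smul_eq_mul, ← dotProduct_smul, ← hv, Matrix.dotProduct_mulVec,
        vecMul_modifiedLaplacian δ hw₁ hw₁_norm, zero_dotProduct]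
    exact (mul_eq_zero.1 h1).resolve_left hν0
  set W := Module.End.eigenspace (Matrix.toLin' M) ν with hW
  have hmemW : ∀ v, v ∈ W ↔ M *ᵥ v = ν • v := fun v => by
    rw [hW, Module.End.mem_eigenspace_iff, Matrix.toLin'_apply]
  have hcomm : NormedSpace.exp (1 - (δ : ℂ) • G.laplacianC) * G.laplacianC =
      G.laplacianC * NormedSpace.exp (1 - (δ : ℂ) • G.laplacianC) := by
    have : Commute (1 - (δ : ℂ) • G.laplacianC) G.laplacianC :=
      (Commute.one_left _).sub_left ((Commute.refl _).smul_left _)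
    exact this.exp_left
  have hmaps : ∀ v ∈ W, Matrix.toLin' G.laplacianC v ∈ W := by
    intro v hv
    rw [hmemW] at hv ⊢
    rw [Matrix.toLin'_apply]
    have h1 : toComplex w₁ ⬝ᵥ (G.laplacianC *ᵥ v) = 0 := by
      rw [Matrix.dotProduct_mulVec, toComplex_dotProduct_laplacianC hw₁, zero_dotProduct]
    rw [modifiedLaplacian_mulVec δ h1, Matrix.mulVec_mulVec, hcomm, ← Matrix.mulVec_mulVec,
      ← modifiedLaplacian_mulVec δ (horth v hv), ← hM, hv, Matrix.mulVec_smul]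
  have hWne : Nontrivial W := by
    rw [Submodule.nontrivial_iff_ne_bot]
    exact hasEigenvalue_toLin'_iff.2 hν
  obtain ⟨μ, hμ⟩ := Module.End.exists_eigenvalue ((Matrix.toLin' G.laplacianC).restrict hmaps)
  obtain ⟨u, hu⟩ := hμ.exists_hasEigenvector
  have hLu : G.laplacianC *ᵥ (u : Fin n → ℂ) = μ • (u : Fin n → ℂ) := by
    have := congrArg Subtype.val hu.apply_eq_smul
    simpa using this
  have hu0 : (u : Fin n → ℂ) ≠ 0 := fun h => hu.2 (Subtype.ext h)
  have hMu := (hmemW _).1 u.2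
  have hwu := horth _ hMu
  refine ⟨μ, ?_, ?_, ?_⟩
  · rw [← hasEigenvalue_toLin'_iff]
    exact Module.End.hasEigenvalue_of_hasEigenvector (x := (u : Fin n → ℂ))
      ⟨by rw [Module.End.mem_eigenspace_iff, Matrix.toLin'_apply, hLu], hu0⟩
  · rintro rfl
    apply hu0
    rw [zero_smul] at hLu
    have hconst := laplacianC_ker hG hLu
    have hw0 : w₁.ofLp ≠ 0 := by
      rw [Ne, WithLp.ofLp_eq_zero]
      rintro rfl
      simp at hw₁_norm
    have hsum := sum_ne_zero_of_vecMul_laplacian hG hw₁ hw0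
    ext i
    have h1 : (∑ j, toComplex w₁ j) * (u : Fin n → ℂ) i = 0 := by
      rw [← hwu, dotProduct, Finset.sum_mul]
      exact Finset.sum_congr rfl fun j _ => by rw [hconst j i]
    have h2 : ∑ j, toComplex w₁ j ≠ 0 := by
      have : ∑ j, toComplex w₁ j = ((∑ j, w₁ j : ℝ) : ℂ) := by simp [toComplex]
      rw [this]; exact_mod_cast hsum
    exact (mul_eq_zero.1 h1).resolve_left h2
  · have h1 := exp_mulVec_of_laplacianC δ hLu
    rw [← modifiedLaplacian_mulVec δ hwu, ← hM, hMu] at h1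
    have h2 : (ν - Complex.exp (1 - δ * μ)) • (u : Fin n → ℂ) = 0 := by
      rw [sub_smul, h1, sub_self]
    exact sub_eq_zero.1 ((smul_eq_zero.1 h2).resolve_right hu0)

theorem rootMultiplicity_conj_modifiedLaplacian (δ : ℝ) (w₁ : EuclideanSpace ℝ (Fin n)) (lam : ℂ) :
    (G.modifiedLaplacian δ w₁).charpoly.rootMultiplicity (conj lam) =
      (G.modifiedLaplacian δ w₁).charpoly.rootMultiplicity lam := by
  have h1 : (G.modifiedLaplacian δ w₁).map (starRingEnd ℂ) = G.modifiedLaplacian δ w₁ := by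
    ext i j; exact Complex.conj_ofReal _
  have h2 := Polynomial.eq_rootMultiplicity_map (p := (G.modifiedLaplacian δ w₁).charpoly)
    (starRingEnd ℂ).injective lam
  rw [h2, ← Matrix.charpoly_map, h1]

end WeightedDigraph

/-! ### The dominant eigenvalue and the generalized algebraic connectivity. -/

/-- If 0 were dominant, it would be the only eigenvalue and have multiplicity n ≥ 2. -/
theorem IsSimpleDominant.ne_zero {n : ℕ} (hn : 2 ≤ n) {M : Matrix (Fin n) (Fin n) ℂ} {lam : ℂ}
    (h : IsSimpleDominant M lam) : lam ≠ 0 := by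
  rintro rfl
  have hroots : ∀ b ∈ M.charpoly.roots, b = 0 := by
    intro b hb
    by_contra hb0
    have hs : b ∈ spectrum ℂ M :=
      Matrix.mem_spectrum_iff_isRoot_charpoly.2 (Polynomial.isRoot_of_mem_roots hb)
    have := h.2 b hs hb0 (by simpa using hb0)
    simp only [norm_zero] at this
    exact absurd this (not_lt.2 (norm_nonneg _))
  have hcard : M.charpoly.roots.card = n := by
    rw [← (IsAlgClosed.splits M.charpoly).natDegree_eq_card_roots, Matrix.charpoly_natDegree_eq_dim,
      Fintype.card_fin]
  have hrep := Multiset.eq_replicate.2 ⟨hcard, hroots⟩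
  have h1 := h.1
  rw [← Polynomial.count_roots, hrep, Multiset.count_replicate_self] at h1
  omega

/-- Since |exp(1 - δμ)| = exp(1 - δ Re μ) decreases in Re μ, the largest modulus corresponds to the
smallest real part. The eigenvalue behind lam shows that the set of real parts is nonempty;
finiteness of the spectrum gives the minimum. -/
theorem isLeast_gac_and_norm_eq {n : ℕ} (hn : 2 ≤ n) {G : WeightedDigraph n}
    (hG : G.StronglyConnected) {w₁ : EuclideanSpace ℝ (Fin n)} (hw₁ : w₁.ofLp ᵥ* G.laplacian = 0)
    (hw₁_norm : ‖w₁‖ = 1) {δ : ℝ} (hδ_pos : 0 < δ) {lam : ℂ}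
    (hlam : IsSimpleDominant (G.modifiedLaplacian δ w₁) lam) :
    IsLeast G.nonzeroEigenvalueRe G.gac ∧ ‖lam‖ = Real.exp (1 - δ * G.gac) := by
  have hlam0 := hlam.ne_zero hn
  have hspec : lam ∈ spectrum ℂ (G.modifiedLaplacian δ w₁) := by
    rw [Matrix.mem_spectrum_iff_isRoot_charpoly]
    exact (Polynomial.rootMultiplicity_pos (Matrix.charpoly_monic _).ne_zero).1
      (by rw [hlam.1]; exact one_pos)
  obtain ⟨μ, hμ, hμ0, rfl⟩ :=
    WeightedDigraph.exists_eq_exp_of_mem_spectrum hG δ hw₁ hw₁_norm hspec hlam0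
  have hfin : G.nonzeroEigenvalueRe.Finite := by
    refine ((Matrix.finite_spectrum G.laplacianC).image Complex.re).subset ?_
    rintro r ⟨κ, hκ, -, rfl⟩
    exact ⟨κ, hκ, rfl⟩
  have hleast : IsLeast G.nonzeroEigenvalueRe G.gac :=
    ⟨Set.Nonempty.csInf_mem ⟨μ.re, μ, hμ, hμ0, rfl⟩ hfin, fun r hr => csInf_le hfin.bddBelow hr⟩
  refine ⟨hleast, ?_⟩
  have hnorm : ∀ κ : ℂ, ‖Complex.exp (1 - δ * κ)‖ = Real.exp (1 - δ * κ.re) := fun κ => by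
    rw [Complex.norm_exp]; simp
  apply le_antisymm
  · rw [hnorm, Real.exp_le_exp]
    have := mul_le_mul_of_nonneg_left (hleast.2 ⟨μ, hμ, hμ0, rfl⟩) hδ_pos.le
    linarith
  · obtain ⟨κ, hκ, hκ0, hre⟩ := hleast.1
    have h1 := WeightedDigraph.exp_mem_spectrum_modifiedLaplacian δ hw₁ hκ hκ0
    rw [← hre, ← hnorm]
    by_cases h2 : Complex.exp (1 - δ * κ) = Complex.exp (1 - δ * μ)
    · rw [h2]
    by_cases h3 : Complex.exp (1 - δ * κ) = conj (Complex.exp (1 - δ * μ))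
    · rw [h3, Complex.norm_conj]
    exact (hlam.2 _ h1 h2 h3).le

theorem IsSimpleDominant.re_pos {n : ℕ} (hn : 2 ≤ n) {G : WeightedDigraph n}
    (hG : G.StronglyConnected) {w₁ : EuclideanSpace ℝ (Fin n)} (hw₁ : w₁.ofLp ᵥ* G.laplacian = 0)
    (hw₁_norm : ‖w₁‖ = 1) {δ : ℝ} (hδ_pos : 0 < δ) (hδ : δ < G.maxInWeight⁻¹) {lam : ℂ}
    (hlam : IsSimpleDominant (G.modifiedLaplacian δ w₁) lam) : 0 < lam.re := by
  have hspec : lam ∈ spectrum ℂ (G.modifiedLaplacian δ w₁) := by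
    rw [Matrix.mem_spectrum_iff_isRoot_charpoly]
    exact (Polynomial.rootMultiplicity_pos (Matrix.charpoly_monic _).ne_zero).1
      (by rw [hlam.1]; exact one_pos)
  obtain ⟨μ, hμ, -, rfl⟩ :=
    WeightedDigraph.exists_eq_exp_of_mem_spectrum hG δ hw₁ hw₁_norm hspec (hlam.ne_zero hn)
  have h1 := abs_le.1 (G.abs_im_mul_le hδ_pos hδ hμ)
  rw [Complex.exp_re]
  refine mul_pos (Real.exp_pos _) (Real.cos_pos_of_mem_Ioo ?_)
  have := Real.pi_gt_three
  have him : (1 - (δ : ℂ) * μ).im = -(δ * μ.im) := by simp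
  rw [him]
  constructor <;> linarith [h1.1, h1.2]

/-! ### From the two subspace estimates to the output of the algorithm. -/

section Estimates

variable {n : ℕ} {M : Matrix (Fin n) (Fin n) ℂ} {x₀ : EuclideanSpace ℂ (Fin n)}

/-- Each ultrafilter eventually takes just one branch of the definition, so each estimate need only
converge along the ultrafilters that select it. -/
theorem tendsto_gacEstimate {lam : ℂ} (hlam0 : lam ≠ 0) {δ : ℝ}
    (hOne : ∀ U : Ultrafilter ℕ, (U : Filter ℕ) ≤ atTop →
      (∀ᶠ k in (U : Filter ℕ), distOne M x₀ k ≤ distTwo M x₀ k) →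
      Tendsto (lamOne M x₀) U (𝓝 ‖lam‖))
    (hTwo : ∀ U : Ultrafilter ℕ, (U : Filter ℕ) ≤ atTop →
      (∀ᶠ k in (U : Filter ℕ), distTwo M x₀ k < distOne M x₀ k) →
      Tendsto (lamTwo M x₀) U (𝓝 ‖lam‖)) :
    Tendsto (gacEstimate M x₀ δ) atTop (𝓝 (1 / δ * (1 - Real.log ‖lam‖))) := by
  rw [← tendsto_add_atTop_iff_nat 2, tendsto_iff_ultrafilter]
  intro U hU
  have hlog : ∀ f : ℕ → ℝ, Tendsto f U (𝓝 ‖lam‖) →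
      Tendsto (fun k => 1 / δ * (1 - Real.log (f k))) U (𝓝 (1 / δ * (1 - Real.log ‖lam‖))) :=
    fun f hf => ((hf.log (norm_ne_zero_iff.2 hlam0)).const_sub 1).const_mul (1 / δ)
  rcases U.em (fun k => distOne M x₀ k ≤ distTwo M x₀ k) with h | h
  · refine (hlog _ (hOne U hU h)).congr' ?_
    filter_upwards [h] with k hk
    simp only [gacEstimate, min_eq_left hk, if_true]
  · have h' : ∀ᶠ k in (U : Filter ℕ), distTwo M x₀ k < distOne M x₀ k :=
      h.mono fun k hk => not_le.1 hk
    refine (hlog _ (hTwo U hU h')).congr' ?_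
    filter_upwards [h'] with k hk
    simp only [gacEstimate, min_eq_right hk.le, if_neg hk.ne]

theorem tendsto_dist_of_tendsto {f : ℕ → ℝ} (hf : Tendsto f atTop (𝓝 0))
    (hle : ∀ k, min (distOne M x₀ k) (distTwo M x₀ k) ≤ f k) {ε : ℝ} (hε : 0 < ε) :
    Tendsto (dist M x₀ ε) atTop (𝓝 0) ∧ ∃ K, 1 ≤ K ∧ dist M x₀ ε K < ε := by
  have h : Tendsto (dist M x₀ ε) atTop (𝓝 0) := by
    rw [← tendsto_add_atTop_iff_nat 2]
    exact tendsto_of_tendsto_of_tendsto_of_le_of_le tendsto_const_nhds hf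
      (fun k => le_min (projDist_nonneg _ _) (projDist_nonneg _ _)) hle
  refine ⟨h, ?_⟩
  obtain ⟨K, hK, hK1⟩ := ((h.eventually_lt_const hε).and (eventually_ge_atTop 1)).exists
  exact ⟨K, hK1, hK⟩

end Estimates

end GPI

/-! ### The convergence theorem. -/

theorem theorem1 {n : ℕ} (hn : 2 ≤ n) (G : GPI.WeightedDigraph n) (hG : G.StronglyConnected)
    (w₁ : EuclideanSpace ℝ (Fin n)) (hw₁ : w₁.ofLp ᵥ* G.laplacian = 0) (hw₁_norm : ‖w₁‖ = 1)
    (δ : ℝ) (hδ_pos : 0 < δ) (hδ : δ < G.maxInWeight⁻¹)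
    (lam : ℂ) (hlam : GPI.IsSimpleDominant (G.modifiedLaplacian δ w₁) lam)
    (x₀ : EuclideanSpace ℂ (Fin n)) (hx₀_norm : ‖x₀‖ = 1)
    (hx₀ : GPI.HasSpectralComponent (G.modifiedLaplacian δ w₁) lam x₀)
    (hx₀' : GPI.HasSpectralComponent (G.modifiedLaplacian δ w₁) (conj lam) x₀) :
    IsLeast G.nonzeroEigenvalueRe G.gac ∧
    (∀ k, GPI.apply (G.modifiedLaplacian δ w₁)
      (GPI.state (G.modifiedLaplacian δ w₁) x₀ k) ≠ 0) ∧
    Tendsto (GPI.gacEstimate (G.modifiedLaplacian δ w₁) x₀ δ) atTop (𝓝 G.gac) ∧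
    (∀ ε : ℝ, 0 < ε →
      Tendsto (GPI.dist (G.modifiedLaplacian δ w₁) x₀ ε) atTop (𝓝 0) ∧
      ∃ K, 1 ≤ K ∧ GPI.dist (G.modifiedLaplacian δ w₁) x₀ ε K < ε) ∧
    (lam.im = 0 →
      (∀ v : EuclideanSpace ℂ (Fin n), v ≠ 0 →
        GPI.apply (G.modifiedLaplacian δ w₁) v = lam • v →
        Tendsto (fun k => GPI.projDist (GPI.projOne (G.modifiedLaplacian δ w₁) x₀ k)
          (GPI.proj (GPI.oneCol v))) atTop (𝓝 0)) ∧
      Tendsto (GPI.lamOne (G.modifiedLaplacian δ w₁) x₀) atTop (𝓝 ‖lam‖)) ∧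
    (lam.im ≠ 0 →
      (∀ v v' : EuclideanSpace ℂ (Fin n), v ≠ 0 → v' ≠ 0 →
        GPI.apply (G.modifiedLaplacian δ w₁) v = lam • v →
        GPI.apply (G.modifiedLaplacian δ w₁) v' = conj lam • v' →
        Tendsto (fun k => GPI.projDist (GPI.projTwo (G.modifiedLaplacian δ w₁) x₀ k)
          (GPI.proj (GPI.twoCol v' v))) atTop (𝓝 0)) ∧
      Tendsto (GPI.lamTwo (G.modifiedLaplacian δ w₁) x₀) atTop (𝓝 ‖lam‖)) := by
  have hlam0 := hlam.ne_zero hn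
  obtain ⟨hleast, hnorm⟩ := GPI.isLeast_gac_and_norm_eq hn hG hw₁ hw₁_norm hδ_pos hlam
  have hre := GPI.IsSimpleDominant.re_pos hn hG hw₁ hw₁_norm hδ_pos hδ hlam
  have hconj : (G.modifiedLaplacian δ w₁).charpoly.rootMultiplicity (conj lam) = 1 := by
    rw [GPI.WeightedDigraph.rootMultiplicity_conj_modifiedLaplacian, hlam.1]
  have hgac : 1 / δ * (1 - Real.log ‖lam‖) = G.gac := by
    rw [hnorm, Real.log_exp]; field_simp; ring
  have hiter := GPI.iter_ne_zero hlam0 hx₀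
  refine ⟨hleast, GPI.apply_state_ne_zero hx₀_norm hiter, ?_⟩
  rw [← hgac]
  generalize G.modifiedLaplacian δ w₁ = M at *
  by_cases him : lam.im = 0
  · obtain ⟨e, he, hMe, hlim⟩ := GPI.exists_tendsto_state him hre hlam hx₀_norm hx₀
    have he0 : e ≠ 0 := by rw [← norm_ne_zero_iff, he]; exact one_ne_zero
    have hP := GPI.tendsto_projOne he0 hlim
    have hl := GPI.tendsto_lamOne he0 hMe hlim
    refine ⟨GPI.tendsto_gacEstimate hlam0 (fun U hU _ => hl.mono_left hU) (fun U hU hlt =>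
        GPI.tendsto_lamTwo_of_distTwo_lt him hre hlam hx₀_norm hiter he hMe hlim U hU hlt),
      fun ε hε => GPI.tendsto_dist_of_tendsto
        (GPI.tendsto_projDist ((tendsto_add_atTop_iff_nat 1).2 hP) hP)
        (fun k => min_le_left _ _) hε, fun _ => ⟨fun v hv hMv => ?_, hl⟩, fun h => absurd him h⟩
    -- Simplicity makes the prescribed eigenvector a multiple of the limit, so both give the same
    -- projection.
    obtain ⟨b, rfl⟩ := GPI.exists_smul_eq_of_simple hlam.1 he0 hMe 0 (v := v) (by simpa using hMv)
    have hb : b ≠ 0 := by rintro rfl; simp at hv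
    rw [GPI.proj_oneCol_smul hb]
    exact GPI.tendsto_projDist hP tendsto_const_nhds
  · obtain ⟨u, u', hu0, hu'0, hu, hu', T, hT, hlim⟩ :=
      GPI.exists_tendsto_pair him hlam hconj hx₀_norm hx₀ hx₀'
    have hne : lam ≠ conj lam := fun h => him (Complex.conj_eq_iff_im.1 h.symm)
    have hind := GPI.linearIndependent_of_eigen hne hu0 hu'0 hu hu'
    have hP := GPI.tendsto_projTwo hind hT hlim
    have hl := GPI.tendsto_lamTwo hind hu hu' hT hlim
    refine ⟨GPI.tendsto_gacEstimate hlam0 (fun U hU hle =>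
        GPI.tendsto_lamOne_of_distOne_le hx₀_norm hiter hind hu hu' hT hlim U hU hle)
        (fun U hU _ => hl.mono_left hU),
      fun ε hε => GPI.tendsto_dist_of_tendsto
        (GPI.tendsto_projDist ((tendsto_add_atTop_iff_nat 1).2 hP) hP)
        (fun k => min_le_right _ _) hε, fun h => absurd h him,
      fun _ => ⟨fun v v' hv hv' hMv hMv' => ?_, hl⟩⟩
    obtain ⟨b, rfl⟩ := GPI.exists_smul_eq_of_simple hlam.1 hu0 hu 0 (v := v) (by simpa using hMv)
    obtain ⟨b', rfl⟩ := GPI.exists_smul_eq_of_simple hconj hu'0 hu' 0 (v := v')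
      (by simpa using hMv')
    have hb : b ≠ 0 := by rintro rfl; simp at hv
    have hb' : b' ≠ 0 := by rintro rfl; simp at hv'
    have hcol : GPI.twoCol (b' • u') (b • u) = GPI.twoCol u' u * !![b', 0; 0, b] := by
      rw [← GPI.twoCol_combination]; simp
    rw [hcol, GPI.proj_mul_right _ (by rw [Matrix.det_fin_two_of]; simp [hb, hb'])]
    exact GPI.tendsto_projDist hP tendsto_const_nhds
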